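/- Let $p_{\mathrm{data}}$ be a probability measure on $\mathbb{R}^d$, and let $\alpha,\sigma$ be schedulers: continuous on $[0,1]$, continuously differentiable on $(0,1)$, $\alpha$ strictly increasing with $\alpha_0=0,\alpha_1=1$, $\sigma$ strictly decreasing with $\sigma_0=1,\sigma_1=0$. Put $$p_t(x|z)=\mathcal{N}(x;\alpha_t z,\sigma_t^2 I_d),\quad p_t(x)=\mathbb{E}_{z\sim p_{\mathrm{data}}}[p_t(x|z)],\quad p_{1|t}(\mathrm{d}z|x)=\frac{p_t(x|z)}{p_t(x)}\,p_{\mathrm{data}}(\mathrm{d}z),$$ $$u_t(x)=\mathbb{E}_{z\sim p_{1|t}(\cdot|x)}\Big[\Big(\dot\alpha_t-\tfrac{\dot\sigma_t}{\sigma_t}\alpha_t\Big)z+\tfrac{\dot\sigma_t}{\sigma_t}x\Big].$$ Let $X_{t,s}$ ($0\le t\le s\le 1$) be the flow map of $u$: for every $t$ and $x$, the curve $s\mapsto X_{t,s}(x)$ is continuous on $[t,1]$, equals $x$ at $s=t$, and satisfies $\partial_sX_{t,s}(x)=u_s(X_{t,s}(x))$ for $s\in(t,1)$. Let $r:\mathbb{R}^d\to\mathbb{R}$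 be a differentiable reward with $\mathbb{E}_{z\sim p_{\mathrm{data}}}[e^{r(z)}]<\infty$, with value function $$V_t^r(x)=\log\mathbb{E}_{z\sim p_{1|t}(\cdot|x)}[e^{r(z)}].$$ Let $0\le t'<t<1$, suppose that $X_{t',1}$ is differentiable, and fix $x_t\in\mathbb{R}^d$. For $x,\epsilon\in\mathbb{R}^d$ define $$x_{t'}(x,\epsilon)=\frac{\alpha_{t'}}{\alpha_t}x+\sqrt{\sigma_{t'}^2-\frac{\alpha_{t'}^2}{\alpha_t^2}\sigma_t^2}\;\epsilon,\qquad z(x,\epsilon)=X_{t',1}(x_{t'}(x,\epsilon)),$$ $$r_{\mathrm{local}}(x,\epsilon)=r(z(x,\epsilon))-\frac{\|x-\alpha_tz(x,\epsilon)\|^2}{2\sigma_t^2}$$ and, writing $x_{t'}=x_{t'}(x_t,\epsilon)$, $$\delta_{\mathrm{score}}(\epsilon)=\frac{\alpha_{t'}}{\alpha_t}\nabla\log p_{t'}(x_{t'})-\nabla\log p_t(x_t),\qquad \gamma(\epsilon)=(x_{t'}-x_t)^T\int_0^1\nabla\log p_{t'}\big(x_t+u(x_{t'}-x_t)\big)\,\mathrm{d}u,$$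 $$v(\epsilon)=r_{\mathrm{local}}(x_t,\epsilon)+\gamma(\epsilon)+\tfrac12\|\epsilon\|^2.$$ Assume that the importance-weighted summand $e^{v(\epsilon)}\big[\nabla_{x_t}r_{\mathrm{local}}(x_t,\epsilon)+\delta_{\mathrm{score}}(\epsilon)\big]$ is integrable for $\epsilon\sim\mathcal{N}(0,I_d)$. Let $\epsilon_1,\epsilon_2,\dots$ be independent with law $\mathcal{N}(0,I_d)$. **Proposition (Weighted Diamond Map).** The value function $V_t^r$ is differentiable at $x_t$, and the weighted Diamond guidance estimator is a consistent estimator of its gradient: as $N\to\infty$, $$\sum_{i=1}^{N}w_i\big[\nabla_{x_t}r_{\mathrm{local}}(x_t,\epsilon_i)+\delta_{\mathrm{score}}(\epsilon_i)\big]\;\longrightarrow\;\nabla_{x_t}V_t^r(x_t)\quad\text{in probability},$$ where $w_i=\dfrac{e^{v(\epsilon_i)}}{\sum_{j=1}^{N}e^{v(\epsilon_j)}}$, i.e. $(w_1,\dots,w_N)=\mathrm{softmax}(v(\epsilon_1),\dots,v(\epsilon_N))$. -/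

import Mathlib

open MeasureTheory ProbabilityTheory Filter Topology

noncomputable section

namespace DiamondMap

/-- Schedulers of a Gaussian probability path: `α` increases strictly from `0` to `1` and `σ`
decreases strictly from `1` to `0` on `[0, 1]`; both are continuous on `[0, 1]` and continuously
differentiable on `(0, 1)`, where their time derivatives enter the conditional vector field. -/
structure IsScheduler (α σ : ℝ → ℝ) : Prop where
  α_zero : α 0 = 0
  α_one : α 1 = 1
  σ_zero : σ 0 = 1
  σ_one : σ 1 = 0
  α_strictMonoOn : StrictMonoOn α (Set.Icc 0 1)
  σ_strictAntiOn : StrictAntiOn σ (Set.Icc 0 1)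
  α_continuousOn : ContinuousOn α (Set.Icc 0 1)
  σ_continuousOn : ContinuousOn σ (Set.Icc 0 1)
  α_contDiffOn : ContDiffOn ℝ 1 α (Set.Ioo 0 1)
  σ_contDiffOn : ContDiffOn ℝ 1 σ (Set.Ioo 0 1)

variable {d : ℕ}

/-- The conditional density `p_t(x | z) = N(x; α_t z, σ_t² I_d)`. -/
def condDensity (α σ : ℝ → ℝ) (t : ℝ) (x z : EuclideanSpace ℝ (Fin d)) : ℝ :=
  (Real.sqrt (2 * Real.pi * σ t ^ 2) ^ d)⁻¹ *
    Real.exp (-(‖x - α t • z‖ ^ 2 / (2 * σ t ^ 2)))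

/-- The marginal density `p_t(x) = E_{z ∼ p_data}[p_t(x | z)]`. -/
def margDensity (α σ : ℝ → ℝ) (pdata : Measure (EuclideanSpace ℝ (Fin d))) (t : ℝ)
    (x : EuclideanSpace ℝ (Fin d)) : ℝ :=
  ∫ z, condDensity α σ t x z ∂pdata

/-- The posterior `p_{1|t}(dz | x) = p_t(x | z) p_data(dz) / p_t(x)`. -/
def posterior (α σ : ℝ → ℝ) (pdata : Measure (EuclideanSpace ℝ (Fin d))) (t : ℝ)
    (x : EuclideanSpace ℝ (Fin d)) : Measure (EuclideanSpace ℝ (Fin d)) :=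
  pdata.withDensity fun z =>
    ENNReal.ofReal (condDensity α σ t x z / margDensity α σ pdata t x)

/-- The score `∇ log p_t(x)`. -/
def score (α σ : ℝ → ℝ) (pdata : Measure (EuclideanSpace ℝ (Fin d))) (t : ℝ)
    (x : EuclideanSpace ℝ (Fin d)) : EuclideanSpace ℝ (Fin d) :=
  gradient (fun y => Real.log (margDensity α σ pdata t y)) x

/-- The conditional vector field
`u_t(x | z) = (α̇_t - (σ̇_t / σ_t) α_t) z + (σ̇_t / σ_t) x`. -/
def condField (α σ : ℝ → ℝ) (t : ℝ) (x z : EuclideanSpace ℝ (Fin d)) :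
    EuclideanSpace ℝ (Fin d) :=
  (deriv α t - deriv σ t / σ t * α t) • z + (deriv σ t / σ t) • x

/-- The marginal vector field `u_t(x) = E_{z ∼ p_{1|t}(· | x)}[u_t(x | z)]`. -/
def margField (α σ : ℝ → ℝ) (pdata : Measure (EuclideanSpace ℝ (Fin d))) (t : ℝ)
    (x : EuclideanSpace ℝ (Fin d)) : EuclideanSpace ℝ (Fin d) :=
  ∫ z, condField α σ t x z ∂(posterior α σ pdata t x)

/-- `X` is the flow map of the marginal vector field: for every `0 ≤ t ≤ 1` and every `x`, the
curve `s ↦ X t s x` is the trajectory on `[t, 1]` of the ODE `ẋ_s = u_s(x_s)` that starts from `x`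
at time `t` (continuous up to time `1`, where `u` itself may be singular). -/
structure IsFlowMap (α σ : ℝ → ℝ) (pdata : Measure (EuclideanSpace ℝ (Fin d)))
    (X : ℝ → ℝ → EuclideanSpace ℝ (Fin d) → EuclideanSpace ℝ (Fin d)) : Prop where
  self : ∀ t ∈ Set.Icc (0 : ℝ) 1, ∀ x, X t t x = x
  continuousOn : ∀ t ∈ Set.Icc (0 : ℝ) 1, ∀ x,
    ContinuousOn (fun s => X t s x) (Set.Icc t 1)
  hasDerivAt : ∀ t ∈ Set.Icc (0 : ℝ) 1, ∀ x, ∀ s ∈ Set.Ioo t 1,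
    HasDerivAt (fun s' => X t s' x) (margField α σ pdata s (X t s x)) s

/-- The value function `V_t^r(x) = log E_{z ∼ p_{1|t}(· | x)}[exp (r z)]`. -/
def valueFn (α σ : ℝ → ℝ) (pdata : Measure (EuclideanSpace ℝ (Fin d)))
    (r : EuclideanSpace ℝ (Fin d) → ℝ) (t : ℝ) (x : EuclideanSpace ℝ (Fin d)) : ℝ :=
  Real.log (∫ z, Real.exp (r z) ∂(posterior α σ pdata t x))

/-- The renoising map `x_{t'}(x, ε)` from time `t` back to time `t'`. -/
def renoise (α σ : ℝ → ℝ) (t' t : ℝ) (x ε : EuclideanSpace ℝ (Fin d)) :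
    EuclideanSpace ℝ (Fin d) :=
  (α t' / α t) • x + Real.sqrt (σ t' ^ 2 - α t' ^ 2 / α t ^ 2 * σ t ^ 2) • ε

/-- The stochastic clean sample `z(x, ε) = X_{t',1}(x_{t'}(x, ε))`. -/
def cleanSample (α σ : ℝ → ℝ)
    (X : ℝ → ℝ → EuclideanSpace ℝ (Fin d) → EuclideanSpace ℝ (Fin d)) (t' t : ℝ)
    (x ε : EuclideanSpace ℝ (Fin d)) : EuclideanSpace ℝ (Fin d) :=
  X t' 1 (renoise α σ t' t x ε)

/-- The local reward `r_local(x, ε) = r(z(x, ε)) - ‖x - α_t z(x, ε)‖² / (2 σ_t²)`. -/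
def localReward (α σ : ℝ → ℝ)
    (X : ℝ → ℝ → EuclideanSpace ℝ (Fin d) → EuclideanSpace ℝ (Fin d))
    (r : EuclideanSpace ℝ (Fin d) → ℝ) (t' t : ℝ) (x ε : EuclideanSpace ℝ (Fin d)) : ℝ :=
  r (cleanSample α σ X t' t x ε) -
    ‖x - α t • cleanSample α σ X t' t x ε‖ ^ 2 / (2 * σ t ^ 2)

/-- The score correction
`δ_score = (α_{t'} / α_t) ∇ log p_{t'}(x_{t'}) - ∇ log p_t(x)`, with `x_{t'} = x_{t'}(x, ε)`. -/
def scoreCorrection (α σ : ℝ → ℝ) (pdata : Measure (EuclideanSpace ℝ (Fin d))) (t' t : ℝ)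
    (x ε : EuclideanSpace ℝ (Fin d)) : EuclideanSpace ℝ (Fin d) :=
  (α t' / α t) • score α σ pdata t' (renoise α σ t' t x ε) - score α σ pdata t x

/-- The line integral
`γ = (x_{t'} - x)ᵀ ∫₀¹ ∇ log p_{t'}(x + u (x_{t'} - x)) du`, with `x_{t'} = x_{t'}(x, ε)`. -/
def gammaCoeff (α σ : ℝ → ℝ) (pdata : Measure (EuclideanSpace ℝ (Fin d))) (t' t : ℝ)
    (x ε : EuclideanSpace ℝ (Fin d)) : ℝ :=
  inner ℝ (renoise α σ t' t x ε - x)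
    (∫ u in (0 : ℝ)..1, score α σ pdata t' (x + u • (renoise α σ t' t x ε - x)))

/-- The log-weight `v = r_local(x, ε) + γ + ‖ε‖² / 2`. -/
def logWeight (α σ : ℝ → ℝ) (pdata : Measure (EuclideanSpace ℝ (Fin d)))
    (X : ℝ → ℝ → EuclideanSpace ℝ (Fin d) → EuclideanSpace ℝ (Fin d))
    (r : EuclideanSpace ℝ (Fin d) → ℝ) (t' t : ℝ) (x ε : EuclideanSpace ℝ (Fin d)) : ℝ :=
  localReward α σ X r t' t x ε + gammaCoeff α σ pdata t' t x ε + 1 / 2 * ‖ε‖ ^ 2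

/-- The vector that is averaged: `∇_x r_local(x, ε) + δ_score`. -/
def guidanceTerm (α σ : ℝ → ℝ) (pdata : Measure (EuclideanSpace ℝ (Fin d)))
    (X : ℝ → ℝ → EuclideanSpace ℝ (Fin d) → EuclideanSpace ℝ (Fin d))
    (r : EuclideanSpace ℝ (Fin d) → ℝ) (t' t : ℝ) (x ε : EuclideanSpace ℝ (Fin d)) :
    EuclideanSpace ℝ (Fin d) :=
  gradient (fun y => localReward α σ X r t' t y ε) x + scoreCorrection α σ pdata t' t x ε

/-- `softmax(v_1, …, v_N)[i] = exp v_i / ∑_j exp v_j`. -/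
def softmax {N : ℕ} (v : Fin N → ℝ) (i : Fin N) : ℝ :=
  Real.exp (v i) / ∑ j, Real.exp (v j)

/-- The weighted Diamond guidance estimator built from the noises `ε_1, …, ε_N`. -/
def guidanceEstimator (α σ : ℝ → ℝ) (pdata : Measure (EuclideanSpace ℝ (Fin d)))
    (X : ℝ → ℝ → EuclideanSpace ℝ (Fin d) → EuclideanSpace ℝ (Fin d))
    (r : EuclideanSpace ℝ (Fin d) → ℝ) (t' t : ℝ) (x : EuclideanSpace ℝ (Fin d)) {N : ℕ}
    (ε : Fin N → EuclideanSpace ℝ (Fin d)) : EuclideanSpace ℝ (Fin d) :=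
  ∑ i, softmax (fun j => logWeight α σ pdata X r t' t x (ε j)) i •
    guidanceTerm α σ pdata X r t' t x (ε i)

end DiamondMap

end

/-!
The flow map `X_{t',1}` transports the density `p_{t'}` to the data law (`map_flow_margDensity`), so
the average of `h` over the data is the integral of `p_{t'}(y) h(X_{t',1}(y))`. With `y` the noised
point `x_{t'}(x, ε)`, the standard Gaussian density of `ε` times `exp v(ε)` is, up to a constant, the
tilted density `f(y) = p_{t'}(y) exp (r(X_{t',1}(y)) - ‖x - α_t X_{t',1}(y)‖² / (2 σ_t²))`: the term
`‖ε‖² / 2` cancels the Gaussian and the line integral `γ` of the score supplies the ratio of the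
values of `p_{t'}` (`gaussDensity_mul_exp_logWeight`). Hence `E[exp v]` is a multiple `κ N(x)` of
`N(x) = ∫ exp r(z) k(x, z) p_data(dz)`, where `k(x, z) = exp (-‖x - α_t z‖² / (2 σ_t²))`. In the
expectation of the weighted guidance terms, the part that comes from moving `y` with `x` is
`(α_{t'} / α_t) ∫ ∇f = 0`, and what remains is `κ (∇N(x) - N(x) ∇ log p_t(x))`
(`exists_integral_logWeight`). The quotient of the two expectations is
`∇N(x) / N(x) - ∇ log p_t(x) = ∇V_t^r(x)` (`hasGradientAt_valueFn`), and the strong law of large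
numbers, applied to numerator and normalisation of the softmax, gives the limit
(`tendstoInMeasure_softmax_sum`).

The transport of `p_{t'}` is the main difficulty: `X_{t',s}` for `s < 1` is not assumed to be
differentiable, or even measurable, in the initial point, and the data law is not assumed to have
moments, so the vector field may be singular at time `0` as well as at time `1`. The proof avoids the continuity
equation. In the coordinate `x / σ_s` and with the signal-to-noise ratio `l = α_s / σ_s`, the flow
solves `Y' = l' m_l(Y)`, where `m_l(y)` is the posterior mean of the signal `Z` given `l Z + ε = y`.
The Markov chain whose step from level `l` to level `m` adds `m - l` times a sample from the posterior
maps the law of `l Z + ε` exactly to that of `m Z + ε`, by Bayes' rule (`stepKernel_comp_noised`).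
Its noise is conditionally centred, so on fine subdivisions the chain follows the trajectory from
the same initial point (`eventually_integral_cost_chain_le`); the Lipschitz constants of `m_l` on
balls sum to a bounded quantity, even as `l` tends to zero, because they are dominated by the
increments of the bounded function `l ↦ E[1 - exp (-l ‖Z‖)]`. Passing to the limit gives
`map_noised_endpoint`.
-/

set_option linter.unusedSectionVars false

noncomputable section

namespace GaussianPosterior

/-! ### The posterior of a signal observed in Gaussian noise -/

section

variable {E : Type*} [NormedAddCommGroup E] [InnerProductSpace ℝ E]

/-- The unnormalised likelihood `exp (-‖y - l z‖² / 2)` of the observation `y = l z + ε`, with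
signal `z`, signal-to-noise ratio `l` and standard Gaussian noise `ε`. -/
def weight (l : ℝ) (y z : E) : ℝ := Real.exp (-(‖y - l • z‖ ^ 2 / 2))

lemma weight_pos (l : ℝ) (y z : E) : 0 < weight l y z := Real.exp_pos _

lemma weight_le_one (l : ℝ) (y z : E) : weight l y z ≤ 1 :=
  Real.exp_le_one_iff.2 (by have := sq_nonneg ‖y - l • z‖; linarith)

lemma continuous_weight : Continuous fun p : ℝ × E × E => weight p.1 p.2.1 p.2.2 := by
  unfold weight; fun_prop

/-- On bounded sets of observations the weight decays exponentially in `l ‖z‖`, at any rate. -/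
lemma weight_le {l R : ℝ} (hl : 0 ≤ l) {y : E} (hy : ‖y‖ ≤ R) (k : ℝ) (z : E) :
    weight l y z ≤ Real.exp ((R + k) ^ 2 / 2) * Real.exp (-(k * (l * ‖z‖))) := by
  rw [weight, ← Real.exp_add, Real.exp_le_exp]
  have h1 : l * ‖z‖ - R ≤ ‖y - l • z‖ := by
    have := norm_sub_norm_le (l • z) y
    rw [norm_smul, Real.norm_of_nonneg hl, norm_sub_rev] at this
    linarith
  have h2 : ‖y - l • z‖ ^ 2 ≥ (l * ‖z‖) ^ 2 - 2 * (l * ‖z‖) * R := by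
    have e : ‖y - l • z‖ ^ 2 = ‖y‖ ^ 2 - 2 * (l * inner ℝ y z) + (l * ‖z‖) ^ 2 := by
      rw [norm_sub_sq_real, inner_smul_right, norm_smul, Real.norm_of_nonneg hl]
    have h3 : l * inner ℝ y z ≤ l * (R * ‖z‖) := by
      gcongr
      exact (real_inner_le_norm y z).trans (by gcongr)
    nlinarith [sq_nonneg ‖y‖]
  nlinarith [sq_nonneg (l * ‖z‖ - R - k)]

lemma le_weight {l R L : ℝ} (hl : 0 ≤ l) (hlL : l ≤ L) {y : E} (hy : ‖y‖ ≤ R) (z : E) :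
    Real.exp (-((R + L * ‖z‖) ^ 2 / 2)) ≤ weight l y z := by
  rw [weight, Real.exp_le_exp]
  have h : ‖y - l • z‖ ≤ R + L * ‖z‖ := by
    refine (norm_sub_le _ _).trans ?_
    rw [norm_smul, Real.norm_of_nonneg hl]
    gcongr
  have := pow_le_pow_left₀ (norm_nonneg _) h 2
  linarith

lemma abs_exp_neg_sub_exp_neg_le (a b : ℝ) :
    |Real.exp (-a) - Real.exp (-b)| ≤ |a - b| * max (Real.exp (-a)) (Real.exp (-b)) := by
  wlog h : a ≤ b generalizing a b
  · rw [abs_sub_comm, abs_sub_comm a, max_comm]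
    exact this b a (le_of_not_ge h)
  have h1 : Real.exp (-b) ≤ Real.exp (-a) := Real.exp_le_exp.2 (by linarith)
  rw [max_eq_left h1, abs_of_nonneg (by linarith), abs_of_nonpos (by linarith)]
  have h2 := Real.add_one_le_exp (-(b - a))
  have h3 : Real.exp (-b) = Real.exp (-a) * Real.exp (-(b - a)) := by
    rw [← Real.exp_add]; ring_nf
  rw [h3]
  nlinarith [Real.exp_pos (-a)]

lemma abs_weight_sub_le {l R : ℝ} (hl : 0 ≤ l) {y y' : E} (hy : ‖y‖ ≤ R) (hy' : ‖y'‖ ≤ R) (z : E) :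
    |weight l y z - weight l y' z| ≤
      ‖y - y'‖ * ((R + 1) * Real.exp ((R + 3) ^ 2 / 2) * Real.exp (-(2 * (l * ‖z‖)))) := by
  have hR : 0 ≤ R := (norm_nonneg _).trans hy
  set s := l * ‖z‖ with hs
  have hs0 : 0 ≤ s := by positivity
  refine (abs_exp_neg_sub_exp_neg_le _ _).trans ?_
  have h1 : max (weight l y z) (weight l y' z) ≤
      Real.exp ((R + 3) ^ 2 / 2) * Real.exp (-(3 * s)) :=
    max_le (weight_le hl hy 3 z) (weight_le hl hy' 3 z)
  have h2 : |‖y - l • z‖ ^ 2 / 2 - ‖y' - l • z‖ ^ 2 / 2| ≤ ‖y - y'‖ * (R + s) := by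
    have e : ‖y - l • z‖ ^ 2 / 2 - ‖y' - l • z‖ ^ 2 / 2 =
        (‖y - l • z‖ - ‖y' - l • z‖) * ((‖y - l • z‖ + ‖y' - l • z‖) / 2) := by ring
    rw [e, abs_mul]
    have a1 : |‖y - l • z‖ - ‖y' - l • z‖| ≤ ‖y - y'‖ := by
      refine (abs_norm_sub_norm_le _ _).trans (le_of_eq ?_)
      congr 1; abel
    have a2 : ∀ x : E, ‖x‖ ≤ R → ‖x - l • z‖ ≤ R + s := fun x hx => by
      refine (norm_sub_le _ _).trans ?_
      rw [norm_smul, Real.norm_of_nonneg hl]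
      linarith
    have a3 : |(‖y - l • z‖ + ‖y' - l • z‖) / 2| ≤ R + s := by
      rw [abs_of_nonneg (by positivity)]
      linarith [a2 y hy, a2 y' hy']
    exact mul_le_mul a1 a3 (abs_nonneg _) (norm_nonneg _)
  have h3 : (R + s) * Real.exp (-(3 * s)) ≤ (R + 1) * Real.exp (-(2 * s)) := by
    have e : Real.exp (-(2 * s)) = Real.exp s * Real.exp (-(3 * s)) := by
      rw [← Real.exp_add]; ring_nf
    rw [e, ← mul_assoc (R + 1)]
    refine mul_le_mul_of_nonneg_right ?_ (Real.exp_pos _).le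
    nlinarith [Real.add_one_le_exp s, Real.one_le_exp hs0, mul_nonneg hR (sub_nonneg.2 (Real.one_le_exp hs0))]
  calc _ ≤ ‖y - y'‖ * (R + s) * (Real.exp ((R + 3) ^ 2 / 2) * Real.exp (-(3 * s))) :=
        mul_le_mul h2 h1 (le_max_of_le_left (weight_pos _ _ _).le) (by positivity)
    _ = ‖y - y'‖ * Real.exp ((R + 3) ^ 2 / 2) * ((R + s) * Real.exp (-(3 * s))) := by ring
    _ ≤ ‖y - y'‖ * Real.exp ((R + 3) ^ 2 / 2) * ((R + 1) * Real.exp (-(2 * s))) := by gcongr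
    _ = _ := by ring

lemma norm_mul_exp_le {l : ℝ} (hl : 0 < l) {k : ℝ} (hk : 1 ≤ k) (z : E) :
    ‖z‖ * Real.exp (-(k * (l * ‖z‖))) ≤ 1 / l := by
  rw [le_div_iff₀ hl]
  have h0 : 0 ≤ l * ‖z‖ := by positivity
  have h1 : l * ‖z‖ ≤ Real.exp (k * (l * ‖z‖)) :=
    (by nlinarith : l * ‖z‖ ≤ k * (l * ‖z‖) + 1).trans (Real.add_one_le_exp _)
  calc _ = (l * ‖z‖) * Real.exp (-(k * (l * ‖z‖))) := by ring
    _ ≤ Real.exp (k * (l * ‖z‖)) * Real.exp (-(k * (l * ‖z‖))) := by gcongr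
    _ = 1 := by rw [← Real.exp_add]; simp

lemma norm_sq_mul_exp_le {l : ℝ} (hl : 0 < l) (z : E) :
    ‖z‖ ^ 2 * Real.exp (-(2 * (l * ‖z‖))) ≤ 1 / l ^ 2 := by
  have h := norm_mul_exp_le hl le_rfl z
  have h2 := pow_le_pow_left₀ (by positivity) h 2
  calc _ = (‖z‖ * Real.exp (-(1 * (l * ‖z‖)))) ^ 2 := by
        rw [mul_pow, ← Real.exp_nat_mul]; congr 2; push_cast; ring
    _ ≤ (1 / l) ^ 2 := h2
    _ = _ := by rw [div_pow, one_pow]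

lemma norm_weight_smul_le {l R : ℝ} (hl : 0 < l) {y : E} (hy : ‖y‖ ≤ R) (z : E) :
    ‖weight l y z • z‖ ≤ Real.exp ((R + 2) ^ 2 / 2) * (‖z‖ * Real.exp (-(2 * (l * ‖z‖)))) := by
  rw [norm_smul, Real.norm_of_nonneg (weight_pos _ _ _).le]
  have := mul_le_mul_of_nonneg_right (weight_le hl.le hy 2 z) (norm_nonneg z)
  linarith

lemma continuous_weight_smul (l : ℝ) (y : E) : Continuous fun z : E => weight l y z • z :=
  (continuous_weight.comp (by fun_prop : Continuous fun z : E => (l, y, z))).smul continuous_id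

variable [FiniteDimensional ℝ E] [MeasurableSpace E] [BorelSpace E]
variable (ρ : Measure E)

/-- The normalising constant of the posterior. -/
def evidence (l : ℝ) (y : E) : ℝ := ∫ z, weight l y z ∂ρ

/-- The posterior law of the signal `Z ∼ ρ` given `l Z + ε = y`. -/
def post (l : ℝ) (y : E) : Measure E :=
  ρ.withDensity fun z => ENNReal.ofReal (weight l y z / evidence ρ l y)

/-- The posterior mean of the signal. -/
def postMean (l : ℝ) (y : E) : E := ∫ z, z ∂(post ρ l y)

variable [IsProbabilityMeasure ρ]

lemma integrable_weight (l : ℝ) (y : E) : Integrable (weight l y) ρ := by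
  refine Integrable.of_bound (C := 1) ?_ (ae_of_all _ fun z => ?_)
  · exact (continuous_weight.comp (by fun_prop : Continuous fun z : E => (l, y, z))).aestronglyMeasurable
  · rw [Real.norm_of_nonneg (weight_pos _ _ _).le]; exact weight_le_one _ _ _

lemma evidence_pos (l : ℝ) (y : E) : 0 < evidence ρ l y := by
  rw [evidence, integral_pos_iff_support_of_nonneg (fun z => (weight_pos l y z).le)
    (integrable_weight ρ l y)]
  have : Function.support (weight l y) = (Set.univ : Set E) := by
    ext z; simp [(weight_pos l y z).ne']
  simp [this]

lemma stronglyMeasurable_evidence (l : ℝ) : StronglyMeasurable (evidence ρ l) := by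
  have : StronglyMeasurable (Function.uncurry fun y z : E => weight l y z) :=
    (continuous_weight.comp (by fun_prop : Continuous fun p : E × E => (l, p.1, p.2))).stronglyMeasurable
  exact this.integral_prod_right

lemma measurable_postDensity (l : ℝ) : Measurable (Function.uncurry fun y z : E =>
    ENNReal.ofReal (weight l y z / evidence ρ l y)) := by
  have h : Measurable (Function.uncurry fun y z : E => weight l y z) :=
    (continuous_weight.comp (by fun_prop : Continuous fun p : E × E => (l, p.1, p.2))).measurable
  have := (stronglyMeasurable_evidence ρ l).measurable
  exact (h.div (this.comp measurable_fst)).ennreal_ofReal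

lemma measurable_postDensity_apply (l : ℝ) (y : E) :
    Measurable fun z => ENNReal.ofReal (weight l y z / evidence ρ l y) :=
  (measurable_postDensity ρ l).of_uncurry_left

lemma integral_post {F : Type*} [NormedAddCommGroup F] [NormedSpace ℝ F] (l : ℝ) (y : E) (f : E → F) :
    ∫ z, f z ∂(post ρ l y) = (evidence ρ l y)⁻¹ • ∫ z, weight l y z • f z ∂ρ := by
  have h0 := evidence_pos ρ l y
  rw [post, integral_withDensity_eq_integral_toReal_smul
    (measurable_postDensity_apply ρ l y) (ae_of_all _ fun z => by simp),
    ← integral_smul]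
  congr 1 with z
  rw [ENNReal.toReal_ofReal (div_nonneg (weight_pos _ _ _).le h0.le), smul_smul]
  congr 1; field_simp

lemma integrable_post_iff {F : Type*} [NormedAddCommGroup F] [NormedSpace ℝ F] (l : ℝ) (y : E)
    (f : E → F) :
    Integrable f (post ρ l y) ↔ Integrable (fun z => weight l y z • f z) ρ := by
  have h0 := evidence_pos ρ l y
  rw [post, integrable_withDensity_iff_integrable_smul'
    (measurable_postDensity_apply ρ l y) (ae_of_all _ fun z => by simp)]
  rw [← integrable_fun_smul_iff (c := evidence ρ l y) h0.ne']
  congr! 2 with z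
  rw [ENNReal.toReal_ofReal (div_nonneg (weight_pos _ _ _).le h0.le), smul_smul]
  congr 1; field_simp

instance isProbabilityMeasure_post (l : ℝ) (y : E) : IsProbabilityMeasure (post ρ l y) := by
  have h0 := evidence_pos ρ l y
  constructor
  rw [post, withDensity_apply _ MeasurableSet.univ, Measure.restrict_univ,
    ← ofReal_integral_eq_lintegral_ofReal ((integrable_weight ρ l y).div_const _)
      (ae_of_all _ fun z => div_nonneg (weight_pos _ _ _).le h0.le), integral_div]
  change ENNReal.ofReal (evidence ρ l y / evidence ρ l y) = 1
  rw [div_self h0.ne', ENNReal.ofReal_one]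

/-- The evidence is bounded below, uniformly over bounded observations and bounded `l`. -/
lemma exists_pos_le_evidence (R L : ℝ) :
    ∃ c > 0, ∀ l y, 0 ≤ l → l ≤ L → ‖y‖ ≤ R → c ≤ evidence ρ l y := by
  have hi : Integrable (fun z : E => Real.exp (-((R + L * ‖z‖) ^ 2 / 2))) ρ := by
    refine Integrable.of_bound (C := 1) (Continuous.aestronglyMeasurable (by fun_prop))
      (ae_of_all _ fun z => ?_)
    rw [Real.norm_of_nonneg (Real.exp_pos _).le]
    exact Real.exp_le_one_iff.2 (by have := sq_nonneg (R + L * ‖z‖); linarith)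
  refine ⟨∫ z, Real.exp (-((R + L * ‖z‖) ^ 2 / 2)) ∂ρ, integral_exp_pos hi, fun l y hl hlL hy => ?_⟩
  exact integral_mono hi (integrable_weight ρ l y) fun z => le_weight hl hlL hy z

/-! ### Moments and regularity of the posterior mean -/

lemma integrable_norm_mul_exp {l : ℝ} (hl : 0 < l) :
    Integrable (fun z : E => ‖z‖ * Real.exp (-(2 * (l * ‖z‖)))) ρ := by
  refine Integrable.of_bound (C := 1 / l) (Continuous.aestronglyMeasurable (by fun_prop))
    (ae_of_all _ fun z => ?_)
  rw [Real.norm_of_nonneg (by positivity)]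
  exact norm_mul_exp_le hl one_le_two z

lemma integrable_weight_smul {l : ℝ} (hl : 0 < l) (y : E) :
    Integrable (fun z => weight l y z • z) ρ :=
  ((integrable_norm_mul_exp ρ hl).const_mul (Real.exp ((‖y‖ + 2) ^ 2 / 2))).mono'
    (continuous_weight_smul l y).aestronglyMeasurable
    (ae_of_all _ fun z => norm_weight_smul_le hl le_rfl z)

lemma integrable_id_post {l : ℝ} (hl : 0 < l) (y : E) : Integrable (fun z => z) (post ρ l y) :=
  (integrable_post_iff ρ l y _).2 (integrable_weight_smul ρ hl y)

lemma norm_sq_weight_le {l R : ℝ} (hl : 0 < l) {y : E} (hy : ‖y‖ ≤ R) (z : E) :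
    weight l y z * ‖z‖ ^ 2 ≤ Real.exp ((R + 2) ^ 2 / 2) * (1 / l ^ 2) := by
  calc _ ≤ (Real.exp ((R + 2) ^ 2 / 2) * Real.exp (-(2 * (l * ‖z‖)))) * ‖z‖ ^ 2 := by
        gcongr; exact weight_le hl.le hy 2 z
    _ = Real.exp ((R + 2) ^ 2 / 2) * (‖z‖ ^ 2 * Real.exp (-(2 * (l * ‖z‖)))) := by ring
    _ ≤ _ := by gcongr; exact norm_sq_mul_exp_le hl z

lemma integrable_weight_norm_sq {l : ℝ} (hl : 0 < l) (y : E) :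
    Integrable (fun z => weight l y z * ‖z‖ ^ 2) ρ := by
  refine Integrable.of_bound (C := Real.exp ((‖y‖ + 2) ^ 2 / 2) * (1 / l ^ 2)) ?_
    (ae_of_all _ fun z => ?_)
  · exact ((continuous_weight.comp (by fun_prop : Continuous fun z : E => (l, y, z))).mul
      (by fun_prop : Continuous fun z : E => ‖z‖ ^ 2)).aestronglyMeasurable
  · rw [Real.norm_of_nonneg (mul_nonneg (weight_pos _ _ _).le (by positivity))]
    exact norm_sq_weight_le hl le_rfl z

lemma integrable_norm_sq_post {l : ℝ} (hl : 0 < l) (y : E) :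
    Integrable (fun z => ‖z‖ ^ 2) (post ρ l y) :=
  (integrable_post_iff ρ l y _).2 (integrable_weight_norm_sq ρ hl y)

/-- The second moment of the posterior grows at most like `l⁻²` as `l → 0`. -/
lemma exists_integral_norm_sq_post_le (R L : ℝ) :
    ∃ C, 0 ≤ C ∧ ∀ l y, 0 < l → l ≤ L → ‖y‖ ≤ R → ∫ z, ‖z‖ ^ 2 ∂(post ρ l y) ≤ C / l ^ 2 := by
  obtain ⟨c, hc, hev⟩ := exists_pos_le_evidence ρ R L
  refine ⟨c⁻¹ * Real.exp ((R + 2) ^ 2 / 2), by positivity, fun l y hl hlL hy => ?_⟩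
  rw [integral_post]
  have h1 : ∫ z, weight l y z • ‖z‖ ^ 2 ∂ρ ≤ Real.exp ((R + 2) ^ 2 / 2) * (1 / l ^ 2) := by
    calc _ ≤ ∫ _, Real.exp ((R + 2) ^ 2 / 2) * (1 / l ^ 2) ∂ρ :=
          integral_mono (integrable_weight_norm_sq ρ hl y) (integrable_const _)
            fun z => norm_sq_weight_le hl hy z
      _ = _ := by simp
  have h2 : (evidence ρ l y)⁻¹ ≤ c⁻¹ := inv_anti₀ hc (hev l y hl.le hlL hy)
  calc _ ≤ c⁻¹ * (Real.exp ((R + 2) ^ 2 / 2) * (1 / l ^ 2)) := by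
        rw [smul_eq_mul]
        refine mul_le_mul h2 h1 (integral_nonneg fun z => ?_) (by positivity)
        exact mul_nonneg (weight_pos _ _ _).le (by positivity)
    _ = _ := by ring

/-- A Lipschitz bound for the posterior mean whose constant is integrable in `l` near `l = 0`,
although `ρ` may have no moments: `∫₀¹ ∫ ‖z‖ exp (-2 l ‖z‖) ρ(dz) dl ≤ 1 / 2`. -/
lemma exists_norm_postMean_sub_le (R L : ℝ) :
    ∃ A, 0 ≤ A ∧ ∀ l y y', 0 < l → l ≤ L → ‖y‖ ≤ R → ‖y'‖ ≤ R →
      ‖postMean ρ l y - postMean ρ l y'‖ ≤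
        A * (∫ z, ‖z‖ * Real.exp (-(2 * (l * ‖z‖))) ∂ρ) * ‖y - y'‖ := by
  obtain ⟨c, hc, hev⟩ := exists_pos_le_evidence ρ R L
  set B := (|R| + 1) * Real.exp ((R + 3) ^ 2 / 2)
  set B' := Real.exp ((R + 2) ^ 2 / 2)
  refine ⟨c⁻¹ * B + c⁻¹ * c⁻¹ * (B * B'), by positivity, fun l y y' hl hlL hy hy' => ?_⟩
  have hR : 0 ≤ R := (norm_nonneg y).trans hy
  set I := ∫ z, ‖z‖ * Real.exp (-(2 * (l * ‖z‖))) ∂ρ with hI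
  have hI0 : 0 ≤ I := integral_nonneg fun z => by positivity
  have hdiff : ∀ z, |weight l y z - weight l y' z| ≤ ‖y - y'‖ * (B * Real.exp (-(2 * (l * ‖z‖)))) :=
    fun z => by simpa only [B, abs_of_nonneg hR] using abs_weight_sub_le hl.le hy hy' z
  set p := ∫ z, weight l y z • z ∂ρ with hp
  set p' := ∫ z, weight l y' z • z ∂ρ with hp'
  set e := evidence ρ l y with he
  set e' := evidence ρ l y' with he'
  have hec : c ≤ e := hev l y hl.le hlL hy
  have hec' : c ≤ e' := hev l y' hl.le hlL hy'
  have h1 : ‖p - p'‖ ≤ ‖y - y'‖ * B * I := by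
    rw [hp, hp', ← integral_sub (integrable_weight_smul ρ hl y) (integrable_weight_smul ρ hl y'),
      hI, ← integral_const_mul]
    refine norm_integral_le_of_norm_le ((integrable_norm_mul_exp ρ hl).const_mul _)
      (ae_of_all _ fun z => ?_)
    rw [← sub_smul, norm_smul, Real.norm_eq_abs]
    have := mul_le_mul_of_nonneg_right (hdiff z) (norm_nonneg z)
    linarith
  have h2 : |e' - e| ≤ ‖y - y'‖ * B := by
    rw [he, he', evidence, evidence,
      ← integral_sub (integrable_weight ρ l y') (integrable_weight ρ l y), ← Real.norm_eq_abs]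
    have : ∀ z, ‖weight l y' z - weight l y z‖ ≤ ‖y - y'‖ * B := fun z => by
      rw [norm_sub_rev, Real.norm_eq_abs]
      refine (hdiff z).trans ?_
      have h : Real.exp (-(2 * (l * ‖z‖))) ≤ 1 := Real.exp_le_one_iff.2 (by
        have : 0 ≤ l * ‖z‖ := by positivity
        linarith)
      calc _ ≤ ‖y - y'‖ * (B * 1) := by gcongr
        _ = _ := by ring
    simpa using norm_integral_le_of_norm_le_const (ae_of_all ρ this)
  have h3 : ‖p'‖ ≤ B' * I := by
    rw [hp', hI, ← integral_const_mul]
    exact norm_integral_le_of_norm_le ((integrable_norm_mul_exp ρ hl).const_mul _)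
      (ae_of_all _ fun z => norm_weight_smul_le hl hy' z)
  have e0 : 0 < e := evidence_pos ρ l y
  have e0' : 0 < e' := evidence_pos ρ l y'
  have i1 : e⁻¹ ≤ c⁻¹ := inv_anti₀ hc hec
  have i2 : e'⁻¹ ≤ c⁻¹ := inv_anti₀ hc hec'
  have key : postMean ρ l y - postMean ρ l y' = e⁻¹ • (p - p') + (e⁻¹ * e'⁻¹ * (e' - e)) • p' := by
    rw [postMean, postMean, integral_post, integral_post, ← hp, ← hp', ← he, ← he']
    have : e⁻¹ * e'⁻¹ * (e' - e) = e⁻¹ - e'⁻¹ := by field_simp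
    rw [this]; module
  rw [key]
  calc _ ≤ ‖e⁻¹ • (p - p')‖ + ‖(e⁻¹ * e'⁻¹ * (e' - e)) • p'‖ := norm_add_le _ _
    _ = e⁻¹ * ‖p - p'‖ + e⁻¹ * e'⁻¹ * |e' - e| * ‖p'‖ := by
        rw [norm_smul, norm_smul, norm_mul, norm_mul, Real.norm_of_nonneg (inv_pos.2 e0).le,
          Real.norm_of_nonneg (inv_pos.2 e0').le, Real.norm_eq_abs]
    _ ≤ c⁻¹ * (‖y - y'‖ * B * I) + c⁻¹ * c⁻¹ * (‖y - y'‖ * B) * (B' * I) := by gcongr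
    _ = _ := by ring

/-- The posterior mean is jointly continuous in the observation and the signal-to-noise ratio. -/
lemma continuousAt_postMean {l : ℝ} (hl : 0 < l) (y : E) :
    ContinuousAt (fun p : ℝ × E => postMean ρ p.1 p.2) (l, y) := by
  have hn : ∀ᶠ p : ℝ × E in 𝓝 (l, y), l / 2 < p.1 ∧ ‖p.2‖ < ‖y‖ + 1 := by
    refine (continuous_fst.tendsto _ |>.eventually (lt_mem_nhds (by simpa using hl))).and ?_
    exact ((continuous_norm.comp continuous_snd).tendsto (l, y)).eventually
      (gt_mem_nhds (by simp))
  have hc : ∀ z : E, Continuous fun p : ℝ × E => weight p.1 p.2 z := fun z =>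
    continuous_weight.comp (by fun_prop : Continuous fun p : ℝ × E => (p.1, p.2, z))
  have h1 : ContinuousAt (fun p : ℝ × E => evidence ρ p.1 p.2) (l, y) := by
    refine continuousAt_of_dominated (bound := fun _ => 1)
      (Eventually.of_forall fun p => (integrable_weight ρ p.1 p.2).aestronglyMeasurable)
      (Eventually.of_forall fun p => ae_of_all _ fun z => ?_) (integrable_const _)
      (ae_of_all _ fun z => (hc z).continuousAt)
    rw [Real.norm_of_nonneg (weight_pos _ _ _).le]; exact weight_le_one _ _ _
  have h2 : ContinuousAt (fun p : ℝ × E => ∫ z, weight p.1 p.2 z • z ∂ρ) (l, y) := by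
    refine continuousAt_of_dominated
      (bound := fun z => Real.exp ((‖y‖ + 1 + 2) ^ 2 / 2) * (‖z‖ * Real.exp (-(2 * (l / 2 * ‖z‖)))))
      (Eventually.of_forall fun p => (continuous_weight_smul p.1 p.2).aestronglyMeasurable)
      ?_ ((integrable_norm_mul_exp ρ (half_pos hl)).const_mul _)
      (ae_of_all _ fun z => ((hc z).smul continuous_const).continuousAt)
    filter_upwards [hn] with p hp
    refine ae_of_all _ fun z => (norm_weight_smul_le (by linarith [hp.1]) hp.2.le z).trans ?_
    gcongr
    exact hp.1.le
  have h3 : (fun p : ℝ × E => postMean ρ p.1 p.2) =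
      fun p => (evidence ρ p.1 p.2)⁻¹ • ∫ z, weight p.1 p.2 z • z ∂ρ := by
    ext1 p; rw [postMean, integral_post]
  rw [h3]
  exact (h1.inv₀ (evidence_pos ρ l y).ne').smul h2

end

/-! ### The standard Gaussian density and Bayes' rule -/

section

variable {E : Type*} [NormedAddCommGroup E] [InnerProductSpace ℝ E]
  [FiniteDimensional ℝ E] [MeasurableSpace E] [BorelSpace E]

variable (E) in
/-- The normalising constant of the standard Gaussian density on `E`. -/
def gaussConst : ℝ := (Real.sqrt (2 * Real.pi) ^ Module.finrank ℝ E)⁻¹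

lemma gaussConst_pos : 0 < gaussConst E := by
  unfold gaussConst
  have := Real.pi_pos
  positivity

variable (E) in
lemma stdGaussian_eq_withDensity : stdGaussian E =
    (volume : Measure E).withDensity
      fun e => ENNReal.ofReal (gaussConst E * Real.exp (-(‖e‖ ^ 2 / 2))) := by
  have hm : Measurable fun e : E => ENNReal.ofReal (gaussConst E * Real.exp (-(‖e‖ ^ 2 / 2))) := by
    fun_prop
  have hnn : ∀ e : E, 0 ≤ gaussConst E * Real.exp (-(‖e‖ ^ 2 / 2)) := fun e =>
    mul_nonneg gaussConst_pos.le (Real.exp_pos _).le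
  have hint : Integrable (fun e : E => gaussConst E * Real.exp (-(‖e‖ ^ 2 / 2))) := by
    have h := GaussianFourier.integrable_cexp_neg_mul_sq_norm_add (V := E) (b := 1 / 2)
      (by norm_num) 0 0
    have h2 := h.norm.const_mul (gaussConst E)
    refine h2.congr (ae_of_all _ fun e => ?_)
    have : (-(1 / 2) * (‖e‖ : ℂ) ^ 2 + 0 * ((inner ℝ (0 : E) e : ℝ) : ℂ)).re = -(‖e‖ ^ 2 / 2) := by
      have h3 : (-(1 / 2) * (‖e‖ : ℂ) ^ 2 + 0 * ((inner ℝ (0 : E) e : ℝ) : ℂ)) =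
          ((-(‖e‖ ^ 2 / 2) : ℝ) : ℂ) := by push_cast; ring
      rw [h3, Complex.ofReal_re]
    simp only [Complex.norm_exp, this]
  have : IsFiniteMeasure ((volume : Measure E).withDensity
      fun e => ENNReal.ofReal (gaussConst E * Real.exp (-(‖e‖ ^ 2 / 2)))) :=
    isFiniteMeasure_withDensity_ofReal hint.2
  refine Measure.ext_of_charFun ?_
  ext t
  rw [charFun_stdGaussian, charFun_apply, integral_withDensity_eq_integral_toReal_smul hm
    (ae_of_all _ fun z => by simp)]
  have e1 : ∀ x : E, (ENNReal.ofReal (gaussConst E * Real.exp (-(‖x‖ ^ 2 / 2)))).toReal •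
      Complex.exp ((inner ℝ x t : ℝ) * Complex.I) = (gaussConst E : ℂ) *
        Complex.exp (-(1 / 2 : ℂ) * (‖x‖ : ℂ) ^ 2 + Complex.I * (inner ℝ t x : ℝ)) := fun x => by
    rw [ENNReal.toReal_ofReal (hnn x), Complex.real_smul, Complex.ofReal_mul, mul_assoc,
      Complex.ofReal_exp, ← Complex.exp_add, real_inner_comm]
    congr 2; push_cast; ring
  simp_rw [e1]
  rw [integral_const_mul, GaussianFourier.integral_cexp_neg_mul_sq_norm_add (by norm_num)]
  have e2 : ((Real.pi : ℂ) / (1 / 2)) ^ ((Module.finrank ℝ E : ℂ) / 2) =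
      ((Real.sqrt (2 * Real.pi) ^ Module.finrank ℝ E : ℝ) : ℂ) := by
    have h0 : 0 ≤ 2 * Real.pi := by positivity
    have : (Real.pi : ℂ) / (1 / 2) = ((2 * Real.pi : ℝ) : ℂ) := by push_cast; ring
    rw [this, Real.sqrt_eq_rpow, ← Real.rpow_natCast, ← Real.rpow_mul h0,
      Complex.ofReal_cpow h0]
    congr 1; push_cast; ring
  rw [e2, ← mul_assoc, ← Complex.ofReal_mul, gaussConst, inv_mul_cancel₀ (by positivity),
    Complex.ofReal_one, one_mul, Complex.I_sq]
  congr 1; ring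

lemma lintegral_stdGaussian (f : E → ENNReal) (hf : Measurable f) :
    ∫⁻ e, f e ∂(stdGaussian E) =
      ∫⁻ e, ENNReal.ofReal (gaussConst E * Real.exp (-(‖e‖ ^ 2 / 2))) * f e := by
  rw [stdGaussian_eq_withDensity, lintegral_withDensity_eq_lintegral_mul _ (by fun_prop) hf]
  rfl

variable (ρ : Measure E) [IsProbabilityMeasure ρ]

/-- The law of `l Z + ε`, for independent `Z ∼ ρ` and `ε` standard Gaussian, given by its density. -/
def noised (l : ℝ) : Measure E :=
  volume.withDensity fun y => ENNReal.ofReal (gaussConst E * evidence ρ l y)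

/-- The posterior as a Markov kernel. -/
def postKernel (l : ℝ) : Kernel E E :=
  (Kernel.const E ρ).withDensity fun y z => ENNReal.ofReal (weight l y z / evidence ρ l y)

lemma postKernel_apply (l : ℝ) (y : E) : postKernel ρ l y = post ρ l y := by
  rw [postKernel, Kernel.withDensity_apply _ (measurable_postDensity ρ l), Kernel.const_apply, post]

instance (l : ℝ) : IsMarkovKernel (postKernel ρ l) :=
  ⟨fun y => by rw [postKernel_apply]; infer_instance⟩

/-- Bayes' rule: drawing `y` from the law of `l Z + ε` and then `z` from the posterior given `y`
produces a pair distributed like `(l Z + ε, Z)`. -/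
lemma lintegral_post_noised (l : ℝ) (f : E × E → ENNReal) (hf : Measurable f) :
    ∫⁻ y, ∫⁻ z, f (y, z) ∂(post ρ l y) ∂(noised ρ l) =
      ∫⁻ z, ∫⁻ e, f (l • z + e, z) ∂(stdGaussian E) ∂ρ := by
  have hw : Measurable fun p : E × E => ENNReal.ofReal (gaussConst E * weight l p.1 p.2) :=
    ((continuous_weight.comp (by fun_prop : Continuous fun p : E × E => (l, p.1, p.2))).measurable.const_mul
      _).ennreal_ofReal
  have hev := (stronglyMeasurable_evidence ρ l).measurable
  have hin : Measurable fun y => ∫⁻ z, f (y, z) ∂(post ρ l y) := by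
    simp_rw [← postKernel_apply]
    exact hf.lintegral_kernel_prod_right'
  rw [noised, lintegral_withDensity_eq_lintegral_mul _ (by fun_prop) hin]
  have e1 : ∀ y, ((fun y => ENNReal.ofReal (gaussConst E * evidence ρ l y)) *
      fun y => ∫⁻ z, f (y, z) ∂(post ρ l y)) y =
      ∫⁻ z, ENNReal.ofReal (gaussConst E * weight l y z) * f (y, z) ∂ρ := fun y => by
    have h0 := evidence_pos ρ l y
    have hfy : Measurable fun z => f (y, z) := hf.comp measurable_prodMk_left
    rw [Pi.mul_apply, post, lintegral_withDensity_eq_lintegral_mul _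
      (measurable_postDensity_apply ρ l y) hfy, ← lintegral_const_mul _
      ((measurable_postDensity_apply ρ l y).mul hfy)]
    congr 1 with z
    rw [Pi.mul_apply, ← mul_assoc, ← ENNReal.ofReal_mul (mul_nonneg gaussConst_pos.le h0.le)]
    congr 2; field_simp
  simp_rw [e1]
  rw [lintegral_lintegral_swap (hw.mul hf).aemeasurable]
  congr 1 with z
  rw [lintegral_stdGaussian _ (by fun_prop), ← lintegral_add_left_eq_self _ (l • z)]
  congr 1 with e
  simp [weight]

/-- One step of the posterior chain: from `y`, draw `z` from the posterior given `y` at level `l`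
and move to `y + (m - l) z`. -/
def stepKernel (l m : ℝ) : Kernel E E :=
  (Kernel.id ×ₖ postKernel ρ l).map fun p => p.1 + (m - l) • p.2

lemma stepKernel_apply (l m : ℝ) (y : E) :
    stepKernel ρ l m y = (post ρ l y).map fun z => y + (m - l) • z := by
  rw [stepKernel, Kernel.map_apply _ (by fun_prop), Kernel.prod_apply, Kernel.id_apply,
    postKernel_apply, Measure.dirac_prod, Measure.map_map (by fun_prop) (by fun_prop)]
  rfl

instance (l m : ℝ) : IsMarkovKernel (stepKernel ρ l m) :=
  Kernel.IsMarkovKernel.map _ (by fun_prop)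

/-- The posterior chain transports the laws of `l Z + ε` exactly. -/
lemma stepKernel_comp_noised (l m : ℝ) : (stepKernel ρ l m) ∘ₘ (noised ρ l) = noised ρ m := by
  have key : ∀ (l m : ℝ) (f : E → ENNReal), Measurable f →
      ∫⁻ y, ∫⁻ z, f (y + (m - l) • z) ∂(post ρ l y) ∂(noised ρ l) =
      ∫⁻ z, ∫⁻ e, f (m • z + e) ∂(stdGaussian E) ∂ρ := fun l m f hf => by
    rw [lintegral_post_noised ρ l (fun p => f (p.1 + (m - l) • p.2)) (by fun_prop)]
    congr! 5 with z e
    module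
  refine Measure.ext_of_lintegral _ fun f hf => ?_
  rw [Measure.lintegral_bind (Kernel.aemeasurable _) hf.aemeasurable]
  have e1 : ∀ y, ∫⁻ x, f x ∂(stepKernel ρ l m y) = ∫⁻ z, f (y + (m - l) • z) ∂(post ρ l y) := fun y => by
    rw [stepKernel_apply, lintegral_map hf (by fun_prop)]
  simp_rw [e1]
  rw [key l m f hf, ← key m m f hf]
  simp

instance (l : ℝ) : IsProbabilityMeasure (noised ρ l) := by
  constructor
  have h := lintegral_post_noised ρ l (fun _ => 1) measurable_const
  simpa using h

/-! ### One step of the posterior chain stays close to an Euler step -/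

/-- A bounded potential whose increments dominate the Lipschitz constants of the posterior mean. -/
def potential (l : ℝ) : ℝ := ∫ z, (1 - Real.exp (-(l * ‖z‖))) ∂ρ

lemma integrable_exp_neg {l : ℝ} (hl : 0 ≤ l) :
    Integrable (fun z : E => Real.exp (-(l * ‖z‖))) ρ := by
  refine Integrable.of_bound (C := 1) (Continuous.aestronglyMeasurable (by fun_prop))
    (ae_of_all _ fun z => ?_)
  rw [Real.norm_of_nonneg (Real.exp_pos _).le]
  exact Real.exp_le_one_iff.2 (by have : 0 ≤ l * ‖z‖ := by positivity
                                  linarith)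

lemma potential_nonneg {l : ℝ} (hl : 0 ≤ l) : 0 ≤ potential ρ l :=
  integral_nonneg fun z => by
    have : Real.exp (-(l * ‖z‖)) ≤ 1 := Real.exp_le_one_iff.2 (by
      have : 0 ≤ l * ‖z‖ := by positivity
      linarith)
    simpa using this

lemma potential_le_one {l : ℝ} (hl : 0 ≤ l) : potential ρ l ≤ 1 := by
  have : potential ρ l ≤ ∫ _, (1 : ℝ) ∂ρ :=
    integral_mono ((integrable_const _).sub (integrable_exp_neg ρ hl)) (integrable_const _)
      fun z => by simpa using (Real.exp_pos _).le
  simpa using this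

/-- The comparison rests on `x ≤ exp x - 1` and needs `m ≤ 2 l`, as the integrand on the left is
evaluated at the left end of the interval `[l, m]`. -/
lemma sub_mul_integral_le_potential_sub {l m : ℝ} (hl : 0 < l) (hlm : l ≤ m) (hm : m ≤ 2 * l) :
    (m - l) * ∫ z, ‖z‖ * Real.exp (-(2 * (l * ‖z‖))) ∂ρ ≤ potential ρ m - potential ρ l := by
  have hm0 : 0 < m := hl.trans_le hlm
  have hi : ∀ k, 0 < k → Integrable (fun z : E => 1 - Real.exp (-(k * ‖z‖))) ρ := fun k hk =>
    (integrable_const _).sub (integrable_exp_neg ρ hk.le)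
  rw [potential, potential, ← integral_sub (hi m hm0) (hi l hl), ← integral_const_mul]
  refine integral_mono ((integrable_norm_mul_exp ρ hl).const_mul _) ((hi m hm0).sub (hi l hl))
    fun z => ?_
  have hz := norm_nonneg z
  have h1 : Real.exp (-(2 * (l * ‖z‖))) ≤ Real.exp (-(m * ‖z‖)) :=
    Real.exp_le_exp.2 (by nlinarith)
  have h2 : Real.exp (-(l * ‖z‖)) = Real.exp (-(m * ‖z‖)) * Real.exp ((m - l) * ‖z‖) := by
    rw [← Real.exp_add]; ring_nf
  have h3 := Real.add_one_le_exp ((m - l) * ‖z‖)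
  have h4 : 0 ≤ (m - l) * ‖z‖ := mul_nonneg (by linarith) hz
  simp only
  rw [h2]
  nlinarith [Real.exp_pos (-(m * ‖z‖)), mul_le_mul_of_nonneg_left h1 h4,
    mul_le_mul_of_nonneg_left h3 (Real.exp_pos (-(m * ‖z‖))).le]

/-- The squared distance to `F`, truncated at `1`. -/
def cost (F y : E) : ℝ := min (‖y - F‖ ^ 2) 1

lemma cost_nonneg (F y : E) : 0 ≤ cost F y := le_min (by positivity) zero_le_one

lemma cost_le_one (F y : E) : cost F y ≤ 1 := min_le_right _ _

lemma continuous_cost (F : E) : Continuous (cost F) := by unfold cost; fun_prop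

lemma integrable_cost (F : E) (μ : Measure E) [IsFiniteMeasure μ] : Integrable (cost F) μ :=
  Integrable.of_bound (C := 1) (continuous_cost F).aestronglyMeasurable (ae_of_all _ fun y => by
    rw [Real.norm_of_nonneg (cost_nonneg F y)]; exact cost_le_one F y)

lemma integral_norm_add_smul_sq_post_le {l : ℝ} (hl : 0 < l) (y u : E) (D : ℝ) :
    ∫ z, ‖u + D • z‖ ^ 2 ∂(post ρ l y) ≤
      ‖u + D • postMean ρ l y‖ ^ 2 + D ^ 2 * ∫ z, ‖z‖ ^ 2 ∂(post ρ l y) := by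
  have hi := integrable_id_post ρ hl y
  have hi2 := integrable_norm_sq_post ρ hl y
  have e : ∀ z : E, ‖u + D • z‖ ^ 2 = ‖u‖ ^ 2 + 2 * D * inner ℝ u z + D ^ 2 * ‖z‖ ^ 2 := fun z => by
    rw [norm_add_sq_real, inner_smul_right, norm_smul, mul_pow, Real.norm_eq_abs, sq_abs]; ring
  have e2 : ∫ z, inner ℝ u z ∂(post ρ l y) = inner ℝ u (postMean ρ l y) := integral_inner hi u
  simp_rw [e]
  have i1 : Integrable (fun z => 2 * D * inner ℝ u z) (post ρ l y) := (hi.const_inner u).const_mul _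
  have i2 : Integrable (fun z => ‖u‖ ^ 2 + 2 * D * inner ℝ u z) (post ρ l y) :=
    (integrable_const _).add i1
  rw [integral_add i2 (hi2.const_mul _), integral_add (integrable_const _) i1, integral_const_mul,
    integral_const_mul, e2]
  simp only [integral_const, probReal_univ, one_smul]
  nlinarith [sq_nonneg (D * ‖postMean ρ l y‖)]

/-- One step of the posterior chain compared with a step `F → F'` of a curve that follows the
posterior mean up to an error `F' - F - (m - l) m_l(F)`. The fluctuation of the posterior is
centred, so its contribution to the squared distance is of second order in `m - l`. -/
lemma exists_integral_cost_stepKernel_le (R L : ℝ) :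
    ∃ A C, 0 ≤ A ∧ 0 ≤ C ∧ ∀ (l m : ℝ) (F F' y : E), 0 < l → l ≤ m → m ≤ 2 * l → m ≤ L → ‖F‖ ≤ R →
      ‖F' - F - (m - l) • postMean ρ l F‖ ≤ 1 →
      ∫ x, cost F' x ∂(stepKernel ρ l m y) ≤
        Real.exp (2 * (A * (potential ρ m - potential ρ l))) * cost F y +
          C * (‖F' - F - (m - l) • postMean ρ l F‖ + (m - l) ^ 2 / l ^ 2) := by
  obtain ⟨A, hA, hLip⟩ := exists_norm_postMean_sub_le ρ (R + 1) L
  obtain ⟨C, hC, hSq⟩ := exists_integral_norm_sq_post_le ρ (R + 1) L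
  refine ⟨A, 2 * A + 3 + C, hA, by positivity, fun l m F F' y hl hlm hm hmL hF he => ?_⟩
  set e := F' - F - (m - l) • postMean ρ l F with he_def
  have hm0 : 0 < m := hl.trans_le hlm
  set q := A * (potential ρ m - potential ρ l) with hq
  have hI0 : 0 ≤ ∫ z, ‖z‖ * Real.exp (-(2 * (l * ‖z‖))) ∂ρ := integral_nonneg fun z => by positivity
  have hpot := sub_mul_integral_le_potential_sub ρ hl hlm hm
  have hq0 : 0 ≤ q := mul_nonneg hA (le_trans (mul_nonneg (by linarith) hI0) hpot)
  have hqA : q ≤ A := by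
    have h1 := potential_le_one ρ hm0.le
    have h2 := potential_nonneg ρ hl.le
    nlinarith
  -- Far from `F` the truncated cost is already `1`; near `F` the point `y` lies in the ball of radius
  -- `R + 1`, where the Lipschitz and moment bounds of the posterior hold.
  rcases le_or_gt 1 ‖y - F‖ with hy | hy
  · have h1 : cost F y = 1 := min_eq_right (one_le_pow₀ hy)
    have h2 : ∫ x, cost F' x ∂(stepKernel ρ l m y) ≤ 1 := by
      have := integral_mono (integrable_cost F' (stepKernel ρ l m y)) (integrable_const 1)
        fun x => cost_le_one F' x
      simpa using this
    have h3 : 1 ≤ Real.exp (2 * q) := Real.one_le_exp (by positivity)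
    rw [h1, mul_one]
    have : 0 ≤ (2 * A + 3 + C) * (‖e‖ + (m - l) ^ 2 / l ^ 2) := by positivity
    linarith
  · have hyR : ‖y‖ ≤ R + 1 := by
      have := norm_add_le (y - F) F
      rw [sub_add_cancel] at this
      linarith
    have hlip := hLip l y F hl (hlm.trans hmL) hyR (by linarith)
    have hsq := hSq l y hl (hlm.trans hmL) hyR
    have hcy : cost F y = ‖y - F‖ ^ 2 := min_eq_left (pow_le_one₀ (norm_nonneg _) hy.le)
    have e1 : ∫ x, cost F' x ∂(stepKernel ρ l m y) ≤
        ∫ z, ‖(y - F') + (m - l) • z‖ ^ 2 ∂(post ρ l y) := by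
      rw [stepKernel_apply, integral_map (by fun_prop) (continuous_cost F').aestronglyMeasurable]
      refine integral_mono (Integrable.of_bound (C := 1)
        ((continuous_cost F').comp (by fun_prop)).aestronglyMeasurable (ae_of_all _ fun z => ?_)) ?_
        fun z => ?_
      · rw [Real.norm_of_nonneg (cost_nonneg _ _)]; exact cost_le_one _ _
      · refine (((integrable_norm_sq_post ρ hl y).const_mul (2 * (m - l) ^ 2)).add
          (integrable_const (2 * ‖y - F'‖ ^ 2))).mono'
          (Continuous.aestronglyMeasurable (by fun_prop)) (ae_of_all _ fun z => ?_)
        rw [Real.norm_of_nonneg (by positivity)]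
        have h1 := norm_add_le (y - F') ((m - l) • z)
        have h2 : ‖(m - l) • z‖ ^ 2 = (m - l) ^ 2 * ‖z‖ ^ 2 := by
          rw [norm_smul, mul_pow, Real.norm_eq_abs, sq_abs]
        have h3 := pow_le_pow_left₀ (norm_nonneg _) h1 2
        simp only [Pi.add_apply]
        nlinarith [sq_nonneg (‖y - F'‖ - ‖(m - l) • z‖)]
      · refine (min_le_left _ _).trans (le_of_eq ?_)
        congr 2; abel
    -- The second moment splits into the squared norm of the mean `v` and the centred fluctuation.
    have e2 := integral_norm_add_smul_sq_post_le ρ hl y (y - F') (m - l)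
    set v := y - F' + (m - l) • postMean ρ l y with hv
    have hve : v = (y - F) + (m - l) • (postMean ρ l y - postMean ρ l F) - e := by
      rw [hv, he_def]; module
    have hvn : ‖v‖ ≤ (1 + q) * ‖y - F‖ + ‖e‖ := by
      rw [hve]
      refine (norm_sub_le _ _).trans (add_le_add_left ((norm_add_le _ _).trans ?_) _)
      rw [norm_smul, Real.norm_of_nonneg (by linarith : 0 ≤ m - l)]
      have h1 := mul_le_mul_of_nonneg_left hlip (by linarith : 0 ≤ m - l)
      have h2 := mul_le_mul_of_nonneg_left hpot (mul_nonneg hA (norm_nonneg (y - F)))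
      rw [hq]
      linarith
    have hv2 : ‖v‖ ^ 2 ≤ (1 + q) ^ 2 * ‖y - F‖ ^ 2 + (2 * A + 3) * ‖e‖ := by
      have h1 := pow_le_pow_left₀ (norm_nonneg _) hvn 2
      have h2 : (1 + q) * ‖y - F‖ * ‖e‖ ≤ (1 + A) * ‖e‖ := by
        refine mul_le_mul_of_nonneg_right ?_ (norm_nonneg _)
        nlinarith [norm_nonneg (y - F)]
      nlinarith [norm_nonneg e]
    have hexp : (1 + q) ^ 2 ≤ Real.exp (2 * q) := by
      have h1 := pow_le_pow_left₀ (by positivity) (Real.add_one_le_exp q) 2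
      rw [← Real.exp_nat_mul] at h1
      push_cast at h1
      linarith
    have hs : (m - l) ^ 2 * ∫ z, ‖z‖ ^ 2 ∂(post ρ l y) ≤ C * ((m - l) ^ 2 / l ^ 2) := by
      have := mul_le_mul_of_nonneg_left hsq (sq_nonneg (m - l))
      calc _ ≤ (m - l) ^ 2 * (C / l ^ 2) := this
        _ = _ := by ring
    rw [hcy]
    have h5 : (1 + q) ^ 2 * ‖y - F‖ ^ 2 ≤ Real.exp (2 * q) * ‖y - F‖ ^ 2 := by gcongr
    have h6 : 0 ≤ C * ‖e‖ := by positivity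
    have h7 : 0 ≤ (2 * A + 3) * ((m - l) ^ 2 / l ^ 2) := by positivity
    calc _ ≤ ‖v‖ ^ 2 + (m - l) ^ 2 * ∫ z, ‖z‖ ^ 2 ∂(post ρ l y) := e1.trans e2
      _ ≤ Real.exp (2 * q) * ‖y - F‖ ^ 2 + (2 * A + 3) * ‖e‖ + C * ((m - l) ^ 2 / l ^ 2) := by
        linarith
      _ ≤ _ := by linarith

end

/-! ### The posterior chain follows the trajectories of the posterior mean -/

section

variable {E : Type*} [NormedAddCommGroup E] [InnerProductSpace ℝ E]
  [FiniteDimensional ℝ E] [MeasurableSpace E] [BorelSpace E]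
variable (ρ : Measure E) [IsProbabilityMeasure ρ]

/-- The posterior chain through the levels `l 0, l 1, …`, as a kernel from its initial point. -/
def chain (l : ℕ → ℝ) : ℕ → Kernel E E
  | 0 => Kernel.id
  | k + 1 => stepKernel ρ (l k) (l (k + 1)) ∘ₖ chain l k

instance (l : ℕ → ℝ) (n : ℕ) : IsMarkovKernel (chain ρ l n) := by
  induction n with
  | zero => rw [chain]; infer_instance
  | succ k ih => rw [chain]; infer_instance

lemma chain_comp_noised (l : ℕ → ℝ) (n : ℕ) :
    (chain ρ l n) ∘ₘ (noised ρ (l 0)) = noised ρ (l n) := by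
  induction n with
  | zero => rw [chain, Measure.id_comp]
  | succ k ih => rw [chain, ← Measure.comp_assoc, ih, stepKernel_comp_noised]

/-- A discrete Grönwall inequality: the accumulated cost is controlled by the cost after the first
step and the residuals `F (k + 1) - F k - (l (k + 1) - l k) m (F k)`. -/
lemma exists_integral_cost_chain_le (R L : ℝ) :
    ∃ K, 0 < K ∧ ∀ (l : ℕ → ℝ) (F : ℕ → E) (η : ℝ) (y : E), 0 ≤ η →
      (∀ k, 0 < l (k + 1) ∧ l (k + 1) ≤ l (k + 2) ∧ l (k + 2) ≤ 2 * l (k + 1) ∧ l (k + 1) ≤ L ∧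
        ‖F (k + 1)‖ ≤ R ∧
        ‖F (k + 2) - F (k + 1) - (l (k + 2) - l (k + 1)) • postMean ρ (l (k + 1)) (F (k + 1))‖ ≤ 1 ∧
        ‖F (k + 2) - F (k + 1) - (l (k + 2) - l (k + 1)) • postMean ρ (l (k + 1)) (F (k + 1))‖ +
          (l (k + 2) - l (k + 1)) ^ 2 / l (k + 1) ^ 2 ≤ η * (l (k + 2) - l (k + 1))) →
      ∀ n, ∫ x, cost (F (n + 1)) x ∂(chain ρ l (n + 1) y) ≤
        K * ((∫ x, cost (F 1) x ∂(chain ρ l 1 y)) + η) := by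
  obtain ⟨A, C, hA, hC, hstep⟩ := exists_integral_cost_stepKernel_le ρ R L
  refine ⟨Real.exp (2 * A) * (1 + C * |L|), by positivity, fun l F η y hη h n => ?_⟩
  set c : ℕ → ℝ := fun k => ∫ x, cost (F k) x ∂(chain ρ l k y) with hc
  have hc0 : ∀ k, 0 ≤ c k := fun k => integral_nonneg fun x => cost_nonneg _ _
  -- The growth factors of the steps telescope, because their exponents are increments of the
  -- bounded potential.
  have hmono : ∀ k, potential ρ (l (k + 1)) ≤ potential ρ (l (k + 2)) := fun k => by
    obtain ⟨h1, h2, h3, -⟩ := h k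
    have := sub_mul_integral_le_potential_sub ρ h1 h2 h3
    have h0 : 0 ≤ ∫ z, ‖z‖ * Real.exp (-(2 * (l (k + 1) * ‖z‖))) ∂ρ :=
      integral_nonneg fun z => by positivity
    nlinarith [mul_nonneg (sub_nonneg.2 h2) h0]
  have hrec : ∀ k, c (k + 2) ≤
      Real.exp (2 * (A * (potential ρ (l (k + 2)) - potential ρ (l (k + 1))))) * c (k + 1) +
        C * (η * (l (k + 2) - l (k + 1))) := fun k => by
    obtain ⟨h1, h2, h3, h4, h5, h6, h7⟩ := h k
    have e : c (k + 2) = ∫ x, ∫ x', cost (F (k + 2)) x' ∂(stepKernel ρ (l (k + 1)) (l (k + 2)) x)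
        ∂(chain ρ l (k + 1) y) := by
      rw [hc]
      simp only
      rw [chain, Kernel.integral_comp (by rw [← chain]; exact integrable_cost _ _)]
    rw [e]
    have hb := fun x => hstep (l (k + 1)) (l (k + 2)) (F (k + 1)) (F (k + 2)) x h1 h2 h3 (h (k + 1)).2.2.2.1 h5 h6
    refine (integral_mono ?_ (((integrable_cost (F (k + 1)) _).const_mul _).add (integrable_const _))
      hb).trans ?_
    · refine Integrable.of_bound (C := 1) ?_ (ae_of_all _ fun x => ?_)
      · exact ((continuous_cost _).stronglyMeasurable.integral_kernel).aestronglyMeasurable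
      · rw [Real.norm_of_nonneg (integral_nonneg fun x => cost_nonneg _ _)]
        have := integral_mono (integrable_cost (F (k + 2)) (stepKernel ρ (l (k + 1)) (l (k + 2)) x))
          (integrable_const 1) fun x => cost_le_one _ x
        simpa using this
    · have : ∫ x, (Real.exp (2 * (A * (potential ρ (l (k + 2)) - potential ρ (l (k + 1))))) *
          cost (F (k + 1)) x) ∂(chain ρ l (k + 1) y) = Real.exp (2 * (A * (potential ρ (l (k + 2)) -
          potential ρ (l (k + 1))))) * c (k + 1) := integral_const_mul _ _
      simp only [Pi.add_apply]
      rw [integral_add ((integrable_cost (F (k + 1)) _).const_mul _) (integrable_const _), this]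
      simp only [integral_const, probReal_univ, one_smul]
      gcongr
  have hind : ∀ n, c (n + 1) ≤ Real.exp (2 * (A * (potential ρ (l (n + 1)) - potential ρ (l 1)))) *
      (c 1 + C * (η * (l (n + 1) - l 1))) ∧ l 1 ≤ l (n + 1) ∧
      potential ρ (l 1) ≤ potential ρ (l (n + 1)) := fun n => by
    induction n with
    | zero => simp
    | succ k ih =>
      obtain ⟨ih1, ih2, ih3⟩ := ih
      have hk := h k
      refine ⟨(hrec k).trans ?_, ih2.trans hk.2.1, ih3.trans (hmono k)⟩
      set E1 := Real.exp (2 * (A * (potential ρ (l (k + 2)) - potential ρ (l (k + 1)))))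
      set E2 := Real.exp (2 * (A * (potential ρ (l (k + 1)) - potential ρ (l 1))))
      have hE : Real.exp (2 * (A * (potential ρ (l (k + 1 + 1)) - potential ρ (l 1)))) = E1 * E2 := by
        rw [← Real.exp_add]; ring_nf
      have hE1 : 1 ≤ E1 * E2 := by
        rw [← hE]
        exact Real.one_le_exp (mul_nonneg zero_le_two (mul_nonneg hA
          (sub_nonneg.2 (ih3.trans (hmono k)))))
      rw [hE]
      have h1 : C * (η * (l (k + 2) - l (k + 1))) ≤ E1 * E2 * (C * (η * (l (k + 2) - l (k + 1)))) :=
        le_mul_of_one_le_left (mul_nonneg hC (mul_nonneg hη (sub_nonneg.2 hk.2.1))) hE1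
      have h2 := mul_le_mul_of_nonneg_left ih1 (Real.exp_pos _ : 0 < E1).le
      change _ ≤ E1 * E2 * (c 1 + C * (η * (l (k + 2) - l 1)))
      linarith
  obtain ⟨h1, h2, h3⟩ := hind n
  have hl1 := (h 0).1
  have hln := (h n).1
  have hlL := (h n).2.2.2.1
  have hp1 := potential_le_one ρ hln.le
  have hp0 := potential_nonneg ρ hl1.le
  simp only [zero_add] at hl1 hp0
  have hE : Real.exp (2 * (A * (potential ρ (l (n + 1)) - potential ρ (l 1)))) ≤ Real.exp (2 * A) :=
    Real.exp_le_exp.2 (by nlinarith)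
  refine h1.trans ?_
  have h5 : c 1 + C * (η * (l (n + 1) - l 1)) ≤ (1 + C * |L|) * (c 1 + η) := by
    have : l (n + 1) - l 1 ≤ |L| := by linarith [le_abs_self L]
    have h6 : C * (η * (l (n + 1) - l 1)) ≤ C * (η * |L|) := by gcongr
    have h7 : 0 ≤ C * |L| * c 1 := mul_nonneg (by positivity) (hc0 1)
    linarith
  calc _ ≤ Real.exp (2 * A) * ((1 + C * |L|) * (c 1 + η)) :=
        mul_le_mul hE h5 (add_nonneg (hc0 1) (mul_nonneg hC (mul_nonneg hη (sub_nonneg.2 h2))))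
          (Real.exp_pos _).le
    _ = _ := by rw [mul_assoc]

/-- The times of the uniform subdivision of `[a, b]` into `n` intervals, then constantly `b`. -/
def gridTime (a b : ℝ) (n k : ℕ) : ℝ := min (a + (b - a) * (k / n)) b

/-- The levels of the posterior chain that goes from time `s` to time `a` in one step and then
through a uniform subdivision of `[a, b]`. -/
def gridLevel (l : ℝ → ℝ) (s a b : ℝ) (n : ℕ) : ℕ → ℝ
  | 0 => l s
  | k + 1 => l (gridTime a b n k)

lemma gridTime_zero {a b : ℝ} (hab : a ≤ b) (n : ℕ) : gridTime a b n 0 = a := by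
  simp [gridTime, hab]

lemma gridTime_self (a b : ℝ) {n : ℕ} (hn : 0 < n) : gridTime a b n n = b := by
  have : (n : ℝ) ≠ 0 := by positivity
  simp [gridTime, div_self this]

lemma gridTime_mem {a b : ℝ} (hab : a ≤ b) (n k : ℕ) : gridTime a b n k ∈ Set.Icc a b :=
  ⟨le_min (le_add_of_nonneg_right (mul_nonneg (by linarith) (by positivity))) hab, min_le_right _ _⟩

lemma gridTime_le_succ {a b : ℝ} (hab : a ≤ b) (n k : ℕ) :
    gridTime a b n k ≤ gridTime a b n (k + 1) := by
  unfold gridTime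
  have : 0 ≤ b - a := by linarith
  gcongr
  linarith

lemma gridTime_succ_sub_le {a b : ℝ} (hab : a ≤ b) (n k : ℕ) :
    gridTime a b n (k + 1) - gridTime a b n k ≤ (b - a) / n := by
  have h0 : 0 ≤ (b - a) / n := div_nonneg (by linarith) (by positivity)
  have e : a + (b - a) * (((k + 1 : ℕ) : ℝ) / n) = a + (b - a) * (k / n) + (b - a) / n := by
    push_cast; ring
  unfold gridTime
  rw [e, sub_le_iff_le_add]
  rcases min_cases (a + (b - a) * (k / n)) b with h | h
  · rw [h.1]; exact (min_le_left _ _).trans (by linarith)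
  · rw [h.1]; exact (min_le_right _ _).trans (by linarith)

/-- The residual of the Euler scheme, relative to the increment of `l`, tends to `0` uniformly with
the mesh of the subdivision. -/
lemma eventually_euler_residual_le {l l' : ℝ → ℝ} {F M : ℝ → E} {a b : ℝ} (hab : a < b)
    (hl : ∀ s ∈ Set.Icc a b, HasDerivAt l (l' s) s) (hl' : ∀ s ∈ Set.Icc a b, 0 ≤ l' s)
    (hF : ∀ s ∈ Set.Icc a b, HasDerivAt F (l' s • M s) s) (hM : ContinuousOn M (Set.Icc a b))
    {η : ℝ} (hη : 0 < η) :
    ∀ᶠ n : ℕ in atTop, ∀ k,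
      l (gridTime a b n (k + 1)) - l (gridTime a b n k) ≤ η ∧
      ‖F (gridTime a b n (k + 1)) - F (gridTime a b n k) -
        (l (gridTime a b n (k + 1)) - l (gridTime a b n k)) • M (gridTime a b n k)‖ ≤
        η * (l (gridTime a b n (k + 1)) - l (gridTime a b n k)) := by
  have hlc : ContinuousOn l (Set.Icc a b) := fun s hs => (hl s hs).continuousAt.continuousWithinAt
  obtain ⟨δ₁, hδ₁, h1⟩ := Metric.uniformContinuousOn_iff.1
    (isCompact_Icc.uniformContinuousOn_of_continuous hlc) η hη
  obtain ⟨δ₂, hδ₂, h2⟩ := Metric.uniformContinuousOn_iff.1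
    (isCompact_Icc.uniformContinuousOn_of_continuous hM) η hη
  have ht : Tendsto (fun n : ℕ => (b - a) / (n : ℝ)) atTop (𝓝 0) :=
    tendsto_const_div_atTop_nhds_zero_nat _
  filter_upwards [ht.eventually (gt_mem_nhds (lt_min hδ₁ hδ₂))] with n hn k
  set s := gridTime a b n k
  set s' := gridTime a b n (k + 1)
  have hs : s ∈ Set.Icc a b := gridTime_mem hab.le n k
  have hs' : s' ∈ Set.Icc a b := gridTime_mem hab.le n (k + 1)
  have hss : s ≤ s' := gridTime_le_succ hab.le n k
  have hd : s' - s < min δ₁ δ₂ := (gridTime_succ_sub_le hab.le n k).trans_lt hn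
  have hsub : ∀ u ∈ Set.Icc s s', u ∈ Set.Icc a b := fun u hu => ⟨hs.1.trans hu.1, hu.2.trans hs'.2⟩
  constructor
  · have := h1 s' hs' s hs (by
      rw [Real.dist_eq, abs_of_nonneg (by linarith)]; exact hd.trans_le (min_le_left _ _))
    rw [Real.dist_eq] at this
    exact (le_abs_self _).trans this.le
  · have hf : ∀ u ∈ Set.Icc s s', HasDerivAt (fun u => F u - F s - (l u - l s) • M s)
        (l' u • M u - l' u • M s) u := fun u hu =>
      ((hF u (hsub u hu)).sub_const _).sub (((hl u (hsub u hu)).sub_const _).smul_const _)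
    have hB : ∀ u ∈ Set.Icc s s', HasDerivAt (fun u => η * (l u - l s)) (η * l' u) u := fun u hu =>
      ((hl u (hsub u hu)).sub_const _).const_mul _
    -- The derivative of the residual is `l' u • (M u - M s)`, of norm at most `η l' u`.
    refine image_norm_le_of_norm_deriv_right_le_deriv_boundary' (f := fun u => F u - F s - (l u - l s) • M s)
      (f' := fun u => l' u • M u - l' u • M s) (B := fun u => η * (l u - l s)) (B' := fun u => η * l' u)
      (fun u hu => (hf u hu).continuousAt.continuousWithinAt)
      (fun u hu => (hf u ⟨hu.1, hu.2.le⟩).hasDerivWithinAt) (by simp)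
      (fun u hu => (hB u hu).continuousAt.continuousWithinAt)
      (fun u hu => (hB u ⟨hu.1, hu.2.le⟩).hasDerivWithinAt) (fun u hu => ?_) ⟨hss, le_rfl⟩
    have hu' := hsub u ⟨hu.1, hu.2.le⟩
    rw [← smul_sub, norm_smul, Real.norm_of_nonneg (hl' u hu'), mul_comm]
    have := h2 u hu' s hs (by
      rw [Real.dist_eq, abs_of_nonneg (by linarith [hu.1])]
      exact (by linarith [hu.2] : u - s < min δ₁ δ₂).trans_le (min_le_right _ _))
    rw [dist_eq_norm] at this
    exact mul_le_mul_of_nonneg_right this.le (hl' u hu')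

/-- The posterior chain started on a trajectory `F` of `F' = l' m_l(F)` follows it up to time `b`:
its mean truncated squared distance from `F b` vanishes in the limit of fine subdivisions. The first
step goes to a time `a` close to the initial time `t`, because the second moment of the posterior
may be infinite at level `l t = 0`. -/
lemma eventually_integral_cost_chain_le {l l' : ℝ → ℝ} {F : ℝ → E} {t b : ℝ} (htb : t < b)
    (hlc : ContinuousOn l (Set.Icc t b)) (hFc : ContinuousOn F (Set.Icc t b))
    (hpos : ∀ s ∈ Set.Ioc t b, 0 < l s)
    (hl : ∀ s ∈ Set.Ioc t b, HasDerivAt l (l' s) s) (hl' : ∀ s ∈ Set.Ioc t b, 0 ≤ l' s)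
    (hF : ∀ s ∈ Set.Ioc t b, HasDerivAt F (l' s • postMean ρ (l s) (F s)) s) {η : ℝ} (hη : 0 < η) :
    ∀ᶠ a in 𝓝[>] t, ∀ᶠ n : ℕ in atTop,
      ∫ x, cost (F b) x ∂(chain ρ (gridLevel l t a b n) (n + 1) (F t)) ≤ η := by
  obtain ⟨R, hR⟩ := isCompact_Icc.exists_bound_of_continuousOn hFc
  obtain ⟨L, hL⟩ := isCompact_Icc.exists_bound_of_continuousOn hlc
  obtain ⟨K, hK, hchain⟩ := exists_integral_cost_chain_le ρ R L
  have hta : ∀ᶠ a in 𝓝[>] t, a ∈ Set.Ioo t b := Ioo_mem_nhdsGT htb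
  have hlt : Tendsto l (𝓝[>] t) (𝓝 (l t)) :=
    ((hlc t ⟨le_rfl, htb.le⟩).mono_left (nhdsWithin_le_of_mem
      (mem_of_superset (Ioo_mem_nhdsGT htb) Set.Ioo_subset_Icc_self)))
  have hFt : Tendsto F (𝓝[>] t) (𝓝 (F t)) :=
    ((hFc t ⟨le_rfl, htb.le⟩).mono_left (nhdsWithin_le_of_mem
      (mem_of_superset (Ioo_mem_nhdsGT htb) Set.Ioo_subset_Icc_self)))
  have hfirst : Tendsto (fun a => ∫ z, cost (F a) (F t + (l a - l t) • z) ∂(post ρ (l t) (F t)))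
      (𝓝[>] t) (𝓝 (∫ _, (0 : ℝ) ∂(post ρ (l t) (F t)))) := by
    refine tendsto_integral_filter_of_dominated_convergence (fun _ => 1)
      (Eventually.of_forall fun a => ((continuous_cost _).comp (by fun_prop)).aestronglyMeasurable)
      (Eventually.of_forall fun a => ae_of_all _ fun z => ?_) (integrable_const _)
      (ae_of_all _ fun z => ?_)
    · rw [Real.norm_of_nonneg (cost_nonneg _ _)]; exact cost_le_one _ _
    · have h1 : Tendsto (fun a => F t + (l a - l t) • z - F a) (𝓝[>] t)
          (𝓝 (F t + (l t - l t) • z - F t)) :=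
        (tendsto_const_nhds.add ((hlt.sub_const _).smul_const z)).sub hFt
      have h2 := (h1.norm.pow 2).min (tendsto_const_nhds (x := (1 : ℝ)))
      simpa [cost] using h2
  rw [integral_zero] at hfirst
  filter_upwards [hta, hfirst.eventually (gt_mem_nhds (by positivity : 0 < η / (2 * K)))]
    with a ha hca
  have hIcc : ∀ s ∈ Set.Icc a b, s ∈ Set.Ioc t b := fun s hs => ⟨ha.1.trans_le hs.1, hs.2⟩
  have hla : 0 < l a := hpos a ⟨ha.1, ha.2.le⟩
  have hmono : MonotoneOn l (Set.Icc a b) := by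
    refine monotoneOn_of_deriv_nonneg (convex_Icc a b)
      (fun s hs => (hl s (hIcc s hs)).continuousAt.continuousWithinAt)
      (fun s hs => (hl s (hIcc s (interior_subset hs))).differentiableAt.differentiableWithinAt)
      fun s hs => ?_
    rw [(hl s (hIcc s (interior_subset hs))).deriv]
    exact hl' s (hIcc s (interior_subset hs))
  have hM : ContinuousOn (fun s => postMean ρ (l s) (F s)) (Set.Icc a b) := fun s hs => by
    have h1 := continuousAt_postMean ρ (hpos s (hIcc s hs)) (F s)
    exact (ContinuousAt.comp (f := fun s => (l s, F s)) h1 ((hl s (hIcc s hs)).continuousAt.prodMk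
      (hF s (hIcc s hs)).continuousAt)).continuousWithinAt
  -- The mesh is chosen so small that one step at most doubles the level and that the residuals,
  -- together with the squared increments, are dominated by `η / (2 K)` times the increments.
  set θ := η / (2 * K)
  have hθ : 0 < θ := by positivity
  set ζ := min (l a) (min 1 (θ / (1 + 1 / l a ^ 2))) with hζ_def
  have hζ : 0 < ζ := by positivity
  filter_upwards [eventually_euler_residual_le ha.2 (fun s hs => hl s (hIcc s hs))
    (fun s hs => hl' s (hIcc s hs)) (fun s hs => hF s (hIcc s hs)) hM hζ, eventually_gt_atTop 0]
    with n hn hn0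
  let F' : ℕ → E := fun k => F (gridTime a b n (k - 1))
  have hmain := hchain (gridLevel l t a b n) F' θ (F t) hθ.le (fun k => ?_) n
  · have e1 : F' (n + 1) = F b := by simp [F', gridTime_self a b hn0]
    have e2 : F' 1 = F a := by simp [F', gridTime_zero ha.2.le]
    have e3 : ∫ x, cost (F' 1) x ∂(chain ρ (gridLevel l t a b n) 1 (F t)) =
        ∫ z, cost (F a) (F t + (l a - l t) • z) ∂(post ρ (l t) (F t)) := by
      rw [e2, chain, chain, Kernel.comp_id, stepKernel_apply,
        integral_map (by fun_prop) (continuous_cost _).aestronglyMeasurable]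
      simp [gridLevel, gridTime_zero ha.2.le]
    rw [e1, e3] at hmain
    refine hmain.trans ?_
    calc _ ≤ K * (η / (2 * K) + η / (2 * K)) := by gcongr
      _ = η := by field_simp; ring
  · have hk := gridTime_mem ha.2.le n k
    have hk' := gridTime_mem ha.2.le n (k + 1)
    obtain ⟨h1, h2⟩ := hn k
    have hlk : l a ≤ l (gridTime a b n k) := hmono ⟨le_rfl, ha.2.le⟩ hk hk.1
    have hinc : l (gridTime a b n k) ≤ l (gridTime a b n (k + 1)) :=
      hmono hk hk' (gridTime_le_succ ha.2.le n k)
    have hζ1 : ζ ≤ l a := min_le_left _ _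
    have hζ2 : ζ ≤ 1 := (min_le_right _ _).trans (min_le_left _ _)
    have hζ4 : ζ ≤ θ / (1 + 1 / l a ^ 2) := (min_le_right _ _).trans (min_le_right _ _)
    have hlL : l (gridTime a b n k) ≤ L :=
      (le_abs_self _).trans (hL _ ⟨ha.1.le.trans hk.1, hk.2⟩)
    change 0 < l (gridTime a b n k) ∧ l (gridTime a b n k) ≤ l (gridTime a b n (k + 1)) ∧
      l (gridTime a b n (k + 1)) ≤ 2 * l (gridTime a b n k) ∧ l (gridTime a b n k) ≤ L ∧
      ‖F (gridTime a b n k)‖ ≤ R ∧ ‖F (gridTime a b n (k + 1)) - F (gridTime a b n k) -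
        (l (gridTime a b n (k + 1)) - l (gridTime a b n k)) •
          postMean ρ (l (gridTime a b n k)) (F (gridTime a b n k))‖ ≤ 1 ∧
      ‖F (gridTime a b n (k + 1)) - F (gridTime a b n k) -
        (l (gridTime a b n (k + 1)) - l (gridTime a b n k)) •
          postMean ρ (l (gridTime a b n k)) (F (gridTime a b n k))‖ +
        (l (gridTime a b n (k + 1)) - l (gridTime a b n k)) ^ 2 / l (gridTime a b n k) ^ 2 ≤
        θ * (l (gridTime a b n (k + 1)) - l (gridTime a b n k))
    set D := l (gridTime a b n (k + 1)) - l (gridTime a b n k) with hD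
    have hD0 : 0 ≤ D := sub_nonneg.2 hinc
    refine ⟨hla.trans_le hlk, hinc, by linarith, hlL, hR _ ⟨ha.1.le.trans hk.1, hk.2⟩, ?_, ?_⟩
    · refine h2.trans ?_
      nlinarith
    · have h3 : D ^ 2 / l (gridTime a b n k) ^ 2 ≤ ζ * D * (1 / l a ^ 2) := by
        rw [div_eq_mul_one_div]
        have : D ^ 2 ≤ ζ * D := by nlinarith
        gcongr
      have h4 : ζ * (1 + 1 / l a ^ 2) ≤ θ := (le_div_iff₀ (by positivity)).1 hζ4
      calc _ ≤ ζ * D + ζ * D * (1 / l a ^ 2) := add_le_add h2 h3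
        _ = ζ * (1 + 1 / l a ^ 2) * D := by ring
        _ ≤ θ * D := by gcongr

end

/-! ### The trajectories transport the noised laws to the law of the signal -/

section

variable {E : Type*} [NormedAddCommGroup E] [InnerProductSpace ℝ E]
  [FiniteDimensional ℝ E] [MeasurableSpace E] [BorelSpace E]
variable (ρ : Measure E) [IsProbabilityMeasure ρ]

lemma noised_eq_map (l : ℝ) :
    noised ρ l = (ρ.prod (stdGaussian E)).map fun p => l • p.1 + p.2 := by
  refine Measure.ext_of_lintegral _ fun f hf => ?_
  have h := lintegral_post_noised ρ l (fun p => f p.1) (by fun_prop)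
  simp only [lintegral_const, measure_univ, mul_one] at h
  rw [h, lintegral_map hf (by fun_prop), lintegral_prod _ (by fun_prop)]

lemma tendsto_integral_noised {ι : Type*} {u : Filter ι} [u.IsCountablyGenerated] {s l : ι → ℝ}
    (hs : Tendsto s u (𝓝 0)) (hsl : Tendsto (fun i => s i * l i) u (𝓝 1))
    (φ : BoundedContinuousFunction E ℝ) :
    Tendsto (fun i => ∫ y, φ (s i • y) ∂(noised ρ (l i))) u (𝓝 (∫ z, φ z ∂ρ)) := by
  have e1 : ∀ i, ∫ y, φ (s i • y) ∂(noised ρ (l i)) =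
      ∫ p, φ ((s i * l i) • p.1 + s i • p.2) ∂(ρ.prod (stdGaussian E)) := fun i => by
    have hc : Continuous fun y : E => φ (s i • y) := φ.continuous.comp (by fun_prop)
    rw [noised_eq_map, integral_map (by fun_prop) hc.aestronglyMeasurable]
    simp_rw [smul_add, smul_smul]
  have e2 : ∫ z, φ z ∂ρ = ∫ p, φ p.1 ∂(ρ.prod (stdGaussian E)) := by
    rw [integral_fun_fst (f := fun z => φ z)]; simp
  simp_rw [e1]
  rw [e2]
  refine tendsto_integral_filter_of_dominated_convergence (fun _ => ‖φ‖)
    (Eventually.of_forall fun i => (φ.continuous.comp (by fun_prop)).aestronglyMeasurable)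
    (Eventually.of_forall fun i => ae_of_all _ fun p => φ.norm_coe_le_norm _) (integrable_const _)
    (ae_of_all _ fun p => (φ.continuous.tendsto p.1).comp ?_)
  simpa using (hsl.smul_const p.1).add (hs.smul_const p.2)

lemma exists_norm_sub_le_add_mul_cost (φ : BoundedContinuousFunction E ℝ) (s : ℝ) (p : E) {δ : ℝ}
    (hδ : 0 < δ) : ∃ K, 0 < K ∧ ∀ y, ‖φ (s • y) - φ (s • p)‖ ≤ δ + K * cost p y := by
  have hc : Continuous fun y : E => φ (s • y) := φ.continuous.comp (by fun_prop)
  obtain ⟨r, hr, h⟩ := Metric.continuousAt_iff.1 hc.continuousAt δ hδ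
  have hm : 0 < min (r ^ 2) 1 := by positivity
  refine ⟨(2 * ‖φ‖ + 1) / min (r ^ 2) 1, by positivity, fun y => ?_⟩
  rcases lt_or_ge (dist y p) r with hy | hy
  · have h1 := (h hy).le
    rw [dist_eq_norm] at h1
    have : 0 ≤ (2 * ‖φ‖ + 1) / min (r ^ 2) 1 * cost p y := mul_nonneg (by positivity) (cost_nonneg _ _)
    linarith
  · have h1 : min (r ^ 2) 1 ≤ cost p y := by
      unfold cost
      rw [dist_eq_norm] at hy
      gcongr
    have h2 : 2 * ‖φ‖ + 1 ≤ (2 * ‖φ‖ + 1) / min (r ^ 2) 1 * cost p y := by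
      rw [div_mul_eq_mul_div, le_div_iff₀ hm]
      gcongr
    have h3 := norm_sub_le (φ (s • y)) (φ (s • p))
    have h4 := φ.norm_coe_le_norm (s • y)
    have h5 := φ.norm_coe_le_norm (s • p)
    linarith

lemma eventually_norm_integral_chain_sub_le {l l' : ℝ → ℝ} {F : ℝ → E} {t b : ℝ} (htb : t < b)
    (hlc : ContinuousOn l (Set.Icc t b)) (hFc : ContinuousOn F (Set.Icc t b))
    (hpos : ∀ s ∈ Set.Ioc t b, 0 < l s)
    (hl : ∀ s ∈ Set.Ioc t b, HasDerivAt l (l' s) s) (hl' : ∀ s ∈ Set.Ioc t b, 0 ≤ l' s)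
    (hF : ∀ s ∈ Set.Ioc t b, HasDerivAt F (l' s • postMean ρ (l s) (F s)) s)
    (φ : BoundedContinuousFunction E ℝ) (c : ℝ) {δ : ℝ} (hδ : 0 < δ) :
    ∀ᶠ a in 𝓝[>] t, ∀ᶠ n : ℕ in atTop,
      ‖∫ x, φ (c • x) ∂(chain ρ (gridLevel l t a b n) (n + 1) (F t)) - φ (c • F b)‖ ≤ δ := by
  obtain ⟨K, hK, hcost⟩ := exists_norm_sub_le_add_mul_cost φ c (F b) (half_pos hδ)
  filter_upwards [eventually_integral_cost_chain_le ρ htb hlc hFc hpos hl hl' hF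
    (η := δ / 2 / K) (by positivity)] with a ha
  filter_upwards [ha] with n hn
  set μ := chain ρ (gridLevel l t a b n) (n + 1) (F t)
  have hc : Continuous fun y : E => φ (c • y) := φ.continuous.comp (by fun_prop)
  have hi : Integrable (fun y => φ (c • y)) μ := Integrable.of_bound (C := ‖φ‖)
    hc.aestronglyMeasurable (ae_of_all _ fun y => φ.norm_coe_le_norm _)
  have e : ∫ x, φ (c • x) ∂μ - φ (c • F b) = ∫ x, (φ (c • x) - φ (c • F b)) ∂μ := by
    rw [integral_sub hi (integrable_const _)]; simp
  rw [e]
  calc _ ≤ ∫ x, (δ / 2 + K * cost (F b) x) ∂μ :=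
        norm_integral_le_of_norm_le ((integrable_const _).add ((integrable_cost _ _).const_mul _))
          (ae_of_all _ hcost)
    _ = δ / 2 + K * ∫ x, cost (F b) x ∂μ := by
        rw [integral_add (integrable_const _) ((integrable_cost _ _).const_mul _),
          integral_const_mul]
        simp
    _ ≤ δ / 2 + K * (δ / 2 / K) := by gcongr
    _ = δ := by field_simp; norm_num

lemma le_lintegral_limsup {α : Type*} [MeasurableSpace α] {μ : Measure α} [IsFiniteMeasure μ]
    {f : ℕ → α → ENNReal} {C D : ENNReal} (hC : C ≠ ⊤) (hf : ∀ n, Measurable (f n))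
    (hfC : ∀ n a, f n a ≤ C) (hD : ∀ n, D ≤ ∫⁻ a, f n a ∂μ) :
    D ≤ ∫⁻ a, limsup (fun n => f n a) atTop ∂μ := by
  refine le_trans ?_ (limsup_lintegral_le (fun _ => C) hf (fun n => ae_of_all _ (hfC n)) ?_)
  · exact le_limsup_of_frequently_le (Frequently.of_forall hD)
  · rw [lintegral_const]; exact ENNReal.mul_ne_top hC (measure_ne_top _ _)

lemma integral_comp_measure {μ : Measure E} [IsProbabilityMeasure μ] (κ : Kernel E E)
    [IsMarkovKernel κ] {f : E → ℝ} (hf : Integrable f (κ ∘ₘ μ)) :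
    ∫ y, f y ∂(κ ∘ₘ μ) = ∫ x, ∫ y, f y ∂(κ x) ∂μ :=
  Kernel.integral_comp (κ := Kernel.const Unit μ) (η := κ) (a := ())
    (by rwa [Kernel.comp_apply, Kernel.const_apply])

set_option maxHeartbeats 1000000 in
/-- Let `Y y` be the trajectories of `Y' = l' m_l(Y)` with `Y y t = y`. If the rescaled trajectories
`s • Y y` have an endpoint `S y` at time `1`, where `s → 0` and `s l → 1`, then `S` transports the
law of `l t Z + ε` to the law `ρ` of `Z`. Only the posterior chain, which transports these laws
exactly, depends measurably on the initial point in an evident way; hence the passage to the limit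
inside the integral over the initial point uses the reverse Fatou lemma. -/
theorem map_noised_endpoint {l l' s : ℝ → ℝ} {t : ℝ} (ht : t < 1) {Y : E → ℝ → E} {S : E → E}
    (hlc : ContinuousOn l (Set.Ico t 1)) (hpos : ∀ u ∈ Set.Ioo t 1, 0 < l u)
    (hl : ∀ u ∈ Set.Ioo t 1, HasDerivAt l (l' u) u) (hl' : ∀ u ∈ Set.Ioo t 1, 0 ≤ l' u)
    (hYc : ∀ y, ContinuousOn (Y y) (Set.Ico t 1)) (hYt : ∀ y, Y y t = y)
    (hY : ∀ y, ∀ u ∈ Set.Ioo t 1, HasDerivAt (Y y) (l' u • postMean ρ (l u) (Y y u)) u)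
    (hs : Tendsto s (𝓝[<] 1) (𝓝 0)) (hsl : Tendsto (fun u => s u * l u) (𝓝[<] 1) (𝓝 1))
    (hS : Measurable S) (hYS : ∀ y, Tendsto (fun u => s u • Y y u) (𝓝[<] 1) (𝓝 (S y))) :
    (noised ρ (l t)).map S = ρ := by
  have := Measure.isProbabilityMeasure_map (μ := noised ρ (l t)) hS.aemeasurable
  refine ext_of_forall_integral_eq_of_IsFiniteMeasure fun φ => ?_
  rw [integral_map hS.aemeasurable φ.continuous.aestronglyMeasurable]
  have hφS : Measurable fun y => φ (S y) := φ.continuous.measurable.comp hS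
  have hintS : Integrable (fun y => φ (S y)) (noised ρ (l t)) :=
    Integrable.of_bound (C := ‖φ‖) hφS.aestronglyMeasurable (ae_of_all _ fun y => φ.norm_coe_le_norm _)
  have hφs : ∀ c : ℝ, Continuous fun y : E => φ (c • y) := fun c => φ.continuous.comp (by fun_prop)
  have hint : ∀ (c : ℝ) (μ : Measure E) [IsProbabilityMeasure μ], Integrable (fun y => φ (c • y)) μ :=
    fun c μ _ => Integrable.of_bound (C := ‖φ‖) (hφs c).aestronglyMeasurable
      (ae_of_all _ fun y => φ.norm_coe_le_norm _)
  obtain ⟨C, hCtop, hC⟩ : ∃ C : ENNReal, C ≠ ⊤ ∧ ∀ x y : ℝ, ‖x‖ ≤ ‖φ‖ → ‖y‖ ≤ ‖φ‖ → ‖x - y‖ₑ ≤ C :=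
    ⟨ENNReal.ofReal (2 * ‖φ‖), ENNReal.ofReal_ne_top, fun x y hx hy => by
      rw [← ofReal_norm]
      exact ENNReal.ofReal_le_ofReal ((norm_sub_le _ _).trans (by linarith))⟩
  -- `g b a n y` compares the chain started at `y` with the endpoint of the trajectory of `y`.
  let g : ℝ → ℝ → ℕ → E → ENNReal := fun b a n y =>
    ‖∫ x, φ (s b • x) ∂(chain ρ (gridLevel l t a b n) (n + 1) y) - φ (S y)‖ₑ
  have hgm : ∀ b a n, Measurable (g b a n) := fun b a n =>
    (((hφs (s b)).stronglyMeasurable.integral_kernel).measurable.sub hφS).enorm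
  have hgC : ∀ b a n y, g b a n y ≤ C := fun b a n y => by
    refine hC _ _ ?_ (φ.norm_coe_le_norm _)
    have := norm_integral_le_of_norm_le_const (μ := chain ρ (gridLevel l t a b n) (n + 1) y)
      (ae_of_all _ fun x => φ.norm_coe_le_norm (s b • x))
    simpa using this
  let D : ℝ → ENNReal := fun b => ‖∫ y, φ (s b • y) ∂(noised ρ (l b)) -
    ∫ y, φ (S y) ∂(noised ρ (l t))‖ₑ
  -- The chain transports the law at level `l t` exactly to the law at level `l b`.
  have hD : ∀ b a n, t ≤ a → a ≤ b → 0 < n → D b ≤ ∫⁻ y, g b a n y ∂(noised ρ (l t)) := by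
    intro b a n _ hab hn
    have h1 := chain_comp_noised ρ (gridLevel l t a b n) (n + 1)
    simp only [gridLevel, gridTime_self a b hn] at h1
    have e : ∫ y, φ (s b • y) ∂(noised ρ (l b)) =
        ∫ y, ∫ x, φ (s b • x) ∂(chain ρ (gridLevel l t a b n) (n + 1) y) ∂(noised ρ (l t)) := by
      rw [← h1]
      exact integral_comp_measure _ (by rw [h1]; exact hint _ _)
    have hi : Integrable (fun y => ∫ x, φ (s b • x) ∂(chain ρ (gridLevel l t a b n) (n + 1) y))
        (noised ρ (l t)) := by
      refine Integrable.of_bound (C := ‖φ‖)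
        ((hφs (s b)).stronglyMeasurable.integral_kernel).aestronglyMeasurable (ae_of_all _ fun y => ?_)
      have := norm_integral_le_of_norm_le_const (μ := chain ρ (gridLevel l t a b n) (n + 1) y)
        (ae_of_all _ fun x => φ.norm_coe_le_norm (s b • x))
      simpa using this
    simp only [D]
    rw [e, ← integral_sub hi hintS]
    exact enorm_integral_le_lintegral_enorm _
  obtain ⟨a, ha⟩ := exists_seq_tendsto (𝓝[>] t)
  obtain ⟨b, hb⟩ := exists_seq_tendsto (𝓝[<] (1 : ℝ))
  obtain ⟨j₀, hj₀⟩ := eventually_atTop.1 (hb.eventually (Ioo_mem_nhdsLT ht))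
  -- First the mesh tends to zero, then the end `a` of the initial step tends to `t`; the end time `b`
  -- tends to `1` last. Upper limits of sequences keep `G j` measurable.
  let G : ℕ → E → ENNReal := fun j y =>
    limsup (fun i => limsup (fun n => g (b (j + j₀)) (a i) n y) atTop) atTop
  have hGm : ∀ j, Measurable (G j) := fun j =>
    Measurable.limsup fun i => Measurable.limsup fun n => hgm _ _ _
  have hLC : ∀ b a y, limsup (fun n => g b a n y) atTop ≤ C := fun b a y =>
    limsup_le_of_le (h := Eventually.of_forall fun n => hgC b a n y)
  have hDG : ∀ j, D (b (j + j₀)) ≤ ∫⁻ y, G j y ∂(noised ρ (l t)) := by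
    intro j
    have hbj := hj₀ (j + j₀) (Nat.le_add_left _ _)
    obtain ⟨i₀, hi₀⟩ := eventually_atTop.1 (ha.eventually (Ioo_mem_nhdsGT hbj.1))
    have h1 : ∀ i, D (b (j + j₀)) ≤
        ∫⁻ y, limsup (fun n => g (b (j + j₀)) (a (i + i₀)) n y) atTop ∂(noised ρ (l t)) := fun i => by
      have hai := hi₀ (i + i₀) (Nat.le_add_left _ _)
      have h2 := le_lintegral_limsup (D := D (b (j + j₀))) hCtop
        (fun n => hgm (b (j + j₀)) (a (i + i₀)) (n + 1))
        (fun n y => hgC _ _ _ y) fun n => hD (b (j + j₀)) (a (i + i₀)) (n + 1) hai.1.le hai.2.le n.succ_pos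
      refine h2.trans (le_of_eq ?_)
      congr 1 with y
      exact limsup_nat_add (fun n => g (b (j + j₀)) (a (i + i₀)) n y) 1
    have h3 := le_lintegral_limsup hCtop
      (fun i => Measurable.limsup fun n => hgm (b (j + j₀)) (a (i + i₀)) n)
      (fun i y => hLC _ _ y) h1
    refine h3.trans (le_of_eq ?_)
    congr 1 with y
    exact limsup_nat_add (fun i => limsup (fun n => g (b (j + j₀)) (a i) n y) atTop) i₀
  -- For a fixed initial point the chain follows the trajectory, so only the distance between the
  -- trajectory at time `β` and its endpoint survives in the limit.
  have hkey : ∀ β ∈ Set.Ioo t 1, ∀ y, limsup (fun i => limsup (fun n => g β (a i) n y) atTop) atTop ≤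
      ‖φ (s β • Y y β) - φ (S y)‖ₑ := by
    intro β hβ y
    have hIoc : ∀ u ∈ Set.Ioc t β, u ∈ Set.Ioo t 1 := fun u hu => ⟨hu.1, hu.2.trans_lt hβ.2⟩
    have hIcc : Set.Icc t β ⊆ Set.Ico t 1 := fun u hu => ⟨hu.1, hu.2.trans_lt hβ.2⟩
    refine ENNReal.le_of_forall_pos_le_add fun δ hδ _ => ?_
    have hev := eventually_norm_integral_chain_sub_le ρ hβ.1 (hlc.mono hIcc) ((hYc y).mono hIcc)
      (fun u hu => hpos u (hIoc u hu)) (fun u hu => hl u (hIoc u hu)) (fun u hu => hl' u (hIoc u hu))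
      (fun u hu => hY y u (hIoc u hu)) φ (s β) hδ
    rw [hYt] at hev
    refine limsup_le_of_le (h := (ha.eventually hev).mono fun i hi => ?_)
    refine limsup_le_of_le (h := hi.mono fun n hn => ?_)
    have h2 := enorm_add_le (∫ x, φ (s β • x) ∂(chain ρ (gridLevel l t (a i) β n) (n + 1) y) -
        φ (s β • Y y β)) (φ (s β • Y y β) - φ (S y))
    rw [sub_add_sub_cancel] at h2
    refine h2.trans ?_
    rw [add_comm]
    gcongr
    rw [← ofReal_norm]
    calc _ ≤ ENNReal.ofReal δ := ENNReal.ofReal_le_ofReal hn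
      _ = δ := ENNReal.ofReal_coe_nnreal
  have hGle : ∀ j y, G j y ≤ ‖φ (s (b (j + j₀)) • Y y (b (j + j₀))) - φ (S y)‖ₑ := fun j y =>
    hkey _ (hj₀ (j + j₀) (Nat.le_add_left _ _)) y
  have hbj : Tendsto (fun j => b (j + j₀)) atTop (𝓝[<] 1) := (tendsto_add_atTop_iff_nat j₀).2 hb
  have hG0 : Tendsto (fun j => ∫⁻ y, G j y ∂(noised ρ (l t))) atTop (𝓝 0) := by
    have := tendsto_lintegral_of_dominated_convergence (μ := noised ρ (l t)) (F := G)
      (f := fun _ => 0) (fun _ => C) hGm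
      (fun j => ae_of_all _ fun y => limsup_le_of_le (h := Eventually.of_forall fun i => hLC _ _ y))
      (by simpa using hCtop) (ae_of_all _ fun y => ?_)
    · simpa using this
    · refine tendsto_of_tendsto_of_tendsto_of_le_of_le tendsto_const_nhds ?_ (fun _ => zero_le)
        (fun j => hGle j y)
      have h1 := ((φ.continuous.tendsto (S y)).comp ((hYS y).comp hbj)).sub_const (φ (S y))
      have h2 := h1.enorm
      simpa using h2
  have hDlim : Tendsto (fun j => D (b (j + j₀))) atTop
      (𝓝 ‖∫ z, φ z ∂ρ - ∫ y, φ (S y) ∂(noised ρ (l t))‖ₑ) :=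
    (((tendsto_integral_noised ρ hs hsl φ).comp hbj).sub_const _).enorm
  have hle := le_of_tendsto_of_tendsto' hDlim hG0 hDG
  have h0 : ‖∫ z, φ z ∂ρ - ∫ y, φ (S y) ∂(noised ρ (l t))‖ₑ = 0 := le_antisymm hle zero_le
  rw [enorm_eq_zero, sub_eq_zero] at h0
  exact h0.symm

end

end GaussianPosterior

namespace DiamondMap

open GaussianPosterior

/-! ### The flow map transports the marginals of the Gaussian path to the data law -/

section

variable {d : ℕ} {α σ : ℝ → ℝ}

lemma IsScheduler.σ_pos (h : IsScheduler α σ) {t : ℝ} (h0 : 0 ≤ t) (h1 : t < 1) : 0 < σ t := by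
  rw [← h.σ_one]
  exact h.σ_strictAntiOn ⟨h0, h1.le⟩ ⟨zero_le_one, le_rfl⟩ h1

lemma IsScheduler.α_pos (h : IsScheduler α σ) {t : ℝ} (h0 : 0 < t) (h1 : t ≤ 1) : 0 < α t := by
  rw [← h.α_zero]
  exact h.α_strictMonoOn ⟨le_rfl, zero_le_one⟩ ⟨h0.le, h1⟩ h0

lemma IsScheduler.α_nonneg (h : IsScheduler α σ) {t : ℝ} (h0 : 0 ≤ t) (h1 : t ≤ 1) : 0 ≤ α t := by
  rcases h0.eq_or_lt with rfl | h0
  · rw [h.α_zero]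
  · exact (h.α_pos h0 h1).le

lemma IsScheduler.hasDerivAt_α (h : IsScheduler α σ) {t : ℝ} (ht : t ∈ Set.Ioo (0 : ℝ) 1) :
    HasDerivAt α (deriv α t) t :=
  ((h.α_contDiffOn.differentiableOn one_ne_zero t ht).differentiableAt (Ioo_mem_nhds ht.1 ht.2)).hasDerivAt

lemma IsScheduler.hasDerivAt_σ (h : IsScheduler α σ) {t : ℝ} (ht : t ∈ Set.Ioo (0 : ℝ) 1) :
    HasDerivAt σ (deriv σ t) t :=
  ((h.σ_contDiffOn.differentiableOn one_ne_zero t ht).differentiableAt (Ioo_mem_nhds ht.1 ht.2)).hasDerivAt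

lemma IsScheduler.deriv_α_nonneg (h : IsScheduler α σ) {t : ℝ} (ht : t ∈ Set.Ioo (0 : ℝ) 1) :
    0 ≤ deriv α t := by
  have h1 := (h.α_strictMonoOn.monotoneOn).derivWithin_nonneg (x := t)
  rwa [derivWithin_of_mem_nhds (Icc_mem_nhds ht.1 ht.2)] at h1

lemma IsScheduler.deriv_σ_nonpos (h : IsScheduler α σ) {t : ℝ} (ht : t ∈ Set.Ioo (0 : ℝ) 1) :
    deriv σ t ≤ 0 := by
  have h1 := (h.σ_strictAntiOn.antitoneOn).derivWithin_nonpos (x := t)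
  rwa [derivWithin_of_mem_nhds (Icc_mem_nhds ht.1 ht.2)] at h1

/-- Division by `σ_t` turns the Gaussian path into the observation of `z` at the signal-to-noise
ratio `α_t / σ_t`. -/
lemma condDensity_eq {t : ℝ} (hσ : 0 < σ t) (x z : EuclideanSpace ℝ (Fin d)) :
    condDensity α σ t x z = (Real.sqrt (2 * Real.pi * σ t ^ 2) ^ d)⁻¹ *
      weight (α t / σ t) ((σ t)⁻¹ • x) z := by
  have e : (σ t)⁻¹ • x - (α t / σ t) • z = (σ t)⁻¹ • (x - α t • z) := by
    rw [smul_sub, smul_smul, div_eq_inv_mul]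
  rw [condDensity, weight, e, norm_smul, Real.norm_of_nonneg (inv_pos.2 hσ).le]
  congr 3
  field_simp

lemma sqrt_pow_inv_pos {s : ℝ} (hs : 0 < s) : 0 < (Real.sqrt (2 * Real.pi * s ^ 2) ^ d)⁻¹ := by
  have := Real.pi_pos
  positivity

variable (pdata : Measure (EuclideanSpace ℝ (Fin d))) [IsProbabilityMeasure pdata]

lemma margDensity_eq {t : ℝ} (hσ : 0 < σ t) (x : EuclideanSpace ℝ (Fin d)) :
    margDensity α σ pdata t x = (Real.sqrt (2 * Real.pi * σ t ^ 2) ^ d)⁻¹ *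
      evidence pdata (α t / σ t) ((σ t)⁻¹ • x) := by
  simp_rw [margDensity, condDensity_eq hσ]
  rw [integral_const_mul, evidence]

lemma margDensity_pos {t : ℝ} (hσ : 0 < σ t) (x : EuclideanSpace ℝ (Fin d)) :
    0 < margDensity α σ pdata t x := by
  rw [margDensity_eq pdata hσ]
  exact mul_pos (sqrt_pow_inv_pos hσ) (evidence_pos _ _ _)

lemma posterior_eq {t : ℝ} (hσ : 0 < σ t) (x : EuclideanSpace ℝ (Fin d)) :
    posterior α σ pdata t x = post pdata (α t / σ t) ((σ t)⁻¹ • x) := by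
  rw [posterior, post]
  congr 1 with z
  rw [condDensity_eq hσ, margDensity_eq pdata hσ, mul_div_mul_left _ _ (sqrt_pow_inv_pos hσ).ne']

lemma margField_eq {t : ℝ} (hσ : 0 < σ t) (hα : 0 < α t) (x : EuclideanSpace ℝ (Fin d)) :
    margField α σ pdata t x = (deriv α t - deriv σ t / σ t * α t) •
      postMean pdata (α t / σ t) ((σ t)⁻¹ • x) + (deriv σ t / σ t) • x := by
  simp_rw [margField, posterior_eq pdata hσ, condField]
  generalize deriv α t - deriv σ t / σ t * α t = c
  have hi : Integrable (fun z => c • z) (post pdata (α t / σ t) ((σ t)⁻¹ • x)) :=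
    (integrable_id_post pdata (div_pos hα hσ) _).fun_smul c
  rw [integral_add hi (integrable_const _), integral_smul, postMean]
  simp

/-- The law with density `p_t`, as the rescaled law of `(α_t / σ_t) Z + ε`. -/
lemma map_noised_smul {t : ℝ} (hσ : 0 < σ t) :
    (noised pdata (α t / σ t)).map (fun y => σ t • y) =
      volume.withDensity fun x => ENNReal.ofReal (margDensity α σ pdata t x) := by
  have hm : Measurable (evidence pdata (α t / σ t)) :=
    (stronglyMeasurable_evidence pdata (α t / σ t)).measurable
  have hme : Measurable fun x => ENNReal.ofReal (margDensity α σ pdata t x) := by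
    simp_rw [margDensity_eq pdata hσ]
    fun_prop
  refine Measure.ext_of_lintegral _ fun f hf => ?_
  rw [lintegral_map hf (by fun_prop), noised, lintegral_withDensity_eq_lintegral_mul _ (by fun_prop)
    (by fun_prop), lintegral_withDensity_eq_lintegral_mul _ hme hf]
  have hd : Module.finrank ℝ (EuclideanSpace ℝ (Fin d)) = d := by simp
  have key := Measure.map_addHaar_smul (volume : Measure (EuclideanSpace ℝ (Fin d))) hσ.ne'
  have h1 : ∀ g : EuclideanSpace ℝ (Fin d) → ENNReal, Measurable g →
      ∫⁻ y, g (σ t • y) = ENNReal.ofReal ((σ t ^ d)⁻¹) * ∫⁻ x, g x := fun g hg => by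
    rw [← lintegral_map hg (by fun_prop), key, lintegral_smul_measure, hd, abs_of_pos (by positivity),
      smul_eq_mul]
  have h2 : ∀ y, ((fun y => ENNReal.ofReal (gaussConst (EuclideanSpace ℝ (Fin d)) *
      evidence pdata (α t / σ t) y)) * fun y => f (σ t • y)) y =
      (fun x => ENNReal.ofReal (gaussConst (EuclideanSpace ℝ (Fin d)) *
        evidence pdata (α t / σ t) ((σ t)⁻¹ • x)) * f x) (σ t • y) := fun y => by
    simp only [Pi.mul_apply, smul_smul, inv_mul_cancel₀ hσ.ne', one_smul]
  rw [lintegral_congr h2, h1 (fun x => ENNReal.ofReal (gaussConst (EuclideanSpace ℝ (Fin d)) *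
    evidence pdata (α t / σ t) ((σ t)⁻¹ • x)) * f x) (by fun_prop), ← lintegral_const_mul _ (by fun_prop)]
  congr 1 with x
  rw [Pi.mul_apply, ← mul_assoc, ← ENNReal.ofReal_mul (by positivity), margDensity_eq pdata hσ,
    gaussConst, hd, ← mul_assoc]
  congr 3
  rw [Real.sqrt_mul (by positivity : 0 ≤ 2 * Real.pi) (σ t ^ 2), Real.sqrt_sq hσ.le, mul_pow, mul_inv,
    mul_comm]

/-- The flow from time `t` to time `1` transports the law with density `p_t` to the data law. -/
theorem map_flow_margDensity (hsched : IsScheduler α σ)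
    {X : ℝ → ℝ → EuclideanSpace ℝ (Fin d) → EuclideanSpace ℝ (Fin d)}
    (hX : IsFlowMap α σ pdata X) {t : ℝ} (h0 : 0 ≤ t) (h1 : t < 1) (hm : Measurable (X t 1)) :
    (volume.withDensity fun x => ENNReal.ofReal (margDensity α σ pdata t x)).map (X t 1) = pdata := by
  have htI : t ∈ Set.Icc (0 : ℝ) 1 := ⟨h0, h1.le⟩
  have hσt := hsched.σ_pos h0 h1
  have hIco : Set.Ico t 1 ⊆ Set.Icc 0 1 := fun u hu => ⟨h0.trans hu.1, hu.2.le⟩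
  have hIoo : Set.Ioo t 1 ⊆ Set.Ioo 0 1 := fun u hu => ⟨h0.trans_lt hu.1, hu.2⟩
  have hσp : ∀ u ∈ Set.Ico t 1, 0 < σ u := fun u hu => hsched.σ_pos (h0.trans hu.1) hu.2
  have hσc : ContinuousOn σ (Set.Ico t 1) := hsched.σ_continuousOn.mono hIco
  have hle : 𝓝[<] (1 : ℝ) ≤ 𝓝[Set.Icc 0 1] 1 :=
    nhdsWithin_le_of_mem (mem_of_superset (Ioo_mem_nhdsLT zero_lt_one) Set.Ioo_subset_Icc_self)
  have hle' : 𝓝[<] (1 : ℝ) ≤ 𝓝[Set.Icc t 1] 1 :=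
    nhdsWithin_le_of_mem (mem_of_superset (Ioo_mem_nhdsLT h1) Set.Ioo_subset_Icc_self)
  have hσ1 : Tendsto σ (𝓝[<] 1) (𝓝 0) := by
    have := (hsched.σ_continuousOn 1 ⟨zero_le_one, le_rfl⟩).mono_left hle
    rwa [hsched.σ_one] at this
  have hα1 : Tendsto α (𝓝[<] 1) (𝓝 1) := by
    have := (hsched.α_continuousOn 1 ⟨zero_le_one, le_rfl⟩).mono_left hle
    rwa [hsched.α_one] at this
  have hev : ∀ᶠ u in 𝓝[<] (1 : ℝ), 0 < σ u :=
    mem_of_superset (Ioo_mem_nhdsLT h1) fun u hu => hσp u ⟨hu.1.le, hu.2⟩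
  have hXc : ∀ y, ContinuousOn (fun s => X t s y) (Set.Icc t 1) := hX.continuousOn t htI
  rw [← map_noised_smul pdata hσt, Measure.map_map hm (by fun_prop)]
  refine map_noised_endpoint pdata h1 (l := fun u => α u / σ u)
    (l' := fun u => (deriv α u * σ u - α u * deriv σ u) / σ u ^ 2) (s := σ)
    (Y := fun y u => (σ u)⁻¹ • X t u (σ t • y)) ?_ ?_ ?_ ?_ ?_ ?_ ?_ hσ1 ?_ (hm.comp (by fun_prop)) ?_
  · exact (hsched.α_continuousOn.mono hIco).div hσc fun u hu => (hσp u hu).ne'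
  · exact fun u hu => div_pos (hsched.α_pos (hIoo hu).1 hu.2.le) (hσp u ⟨hu.1.le, hu.2⟩)
  · exact fun u hu => (hsched.hasDerivAt_α (hIoo hu)).div (hsched.hasDerivAt_σ (hIoo hu))
      (hσp u ⟨hu.1.le, hu.2⟩).ne'
  · intro u hu
    have e1 := hsched.deriv_α_nonneg (hIoo hu)
    have e2 := hsched.deriv_σ_nonpos (hIoo hu)
    have e3 := hσp u ⟨hu.1.le, hu.2⟩
    have e4 := (hsched.α_pos (hIoo hu).1 hu.2.le).le
    exact div_nonneg (by nlinarith [mul_nonneg e1 e3.le, mul_nonneg e4 (neg_nonneg.2 e2)])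
      (by positivity)
  · exact fun y => (hσc.inv₀ fun u hu => (hσp u hu).ne').smul
      ((hXc _).mono Set.Ico_subset_Icc_self)
  · intro y
    rw [hX.self t htI, smul_smul, inv_mul_cancel₀ hσt.ne', one_smul]
  · intro y u hu
    have hσu := hσp u ⟨hu.1.le, hu.2⟩
    have hαu := hsched.α_pos (hIoo hu).1 hu.2.le
    have e1 := ((hsched.hasDerivAt_σ (hIoo hu)).inv hσu.ne').smul
      (hX.hasDerivAt t htI (σ t • y) u hu)
    rw [margField_eq pdata hσu hαu] at e1
    refine HasDerivAt.congr_deriv (f := fun u => (σ u)⁻¹ • X t u (σ t • y)) e1 ?_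
    rw [Pi.inv_apply]
    symm
    rw [smul_add, smul_smul, smul_smul, add_assoc, ← add_smul]
    have e2 : (σ u)⁻¹ * (deriv σ u / σ u) + -deriv σ u / σ u ^ 2 = 0 := by field_simp; ring
    have e3 : (deriv α u * σ u - α u * deriv σ u) / σ u ^ 2 =
        (σ u)⁻¹ * (deriv α u - deriv σ u / σ u * α u) := by field_simp
    rw [e2, zero_smul, add_zero, e3]
  · refine hα1.congr' (hev.mono fun u hu => ?_)
    field_simp
  · intro y
    have e1 : Tendsto (fun u => X t u (σ t • y)) (𝓝[<] 1) (𝓝 (X t 1 (σ t • y))) :=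
      (hXc (σ t • y) 1 ⟨h1.le, le_rfl⟩).mono_left hle'
    refine e1.congr' (hev.mono fun u hu => ?_)
    simp only [smul_smul, mul_inv_cancel₀ hu.ne', one_smul]

end

/-! ### Gaussian mixtures and their gradients -/

section Mixture

variable {E : Type*} [NormedAddCommGroup E] [InnerProductSpace ℝ E]

/-- The unnormalised density `exp (-‖x - a z‖² / (2 s²))` of `N(x; a z, s² I)`. -/
def gaussKernel (a s : ℝ) (x z : E) : ℝ := Real.exp (-(‖x - a • z‖ ^ 2 / (2 * s ^ 2)))

lemma gaussKernel_pos (a s : ℝ) (x z : E) : 0 < gaussKernel a s x z := Real.exp_pos _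

lemma gaussKernel_le_one (a s : ℝ) (x z : E) : gaussKernel a s x z ≤ 1 :=
  Real.exp_le_one_iff.2 (neg_nonpos.2 (by positivity))

lemma continuous_gaussKernel (a s : ℝ) : Continuous fun p : E × E => gaussKernel a s p.1 p.2 := by
  unfold gaussKernel; fun_prop

/-- The gradient of the Gaussian kernel in its first variable. -/
def gaussKernelGrad (a s : ℝ) (x z : E) : E := -(gaussKernel a s x z * (s ^ 2)⁻¹) • (x - a • z)

lemma continuous_gaussKernelGrad (a s : ℝ) :
    Continuous fun p : E × E => gaussKernelGrad a s p.1 p.2 := by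
  unfold gaussKernelGrad
  exact (((continuous_gaussKernel a s).mul continuous_const).neg).smul (by fun_prop)

lemma norm_gaussKernelGrad_le (a : ℝ) {s : ℝ} (hs : 0 < s) (x z : E) :
    ‖gaussKernelGrad a s x z‖ ≤ s⁻¹ := by
  rw [gaussKernelGrad, norm_smul, norm_neg,
    Real.norm_of_nonneg (mul_nonneg (gaussKernel_pos _ _ _ _).le (by positivity)), gaussKernel]
  set u := ‖x - a • z‖ / s with hu
  have hu0 : 0 ≤ u := by positivity
  have e1 : ‖x - a • z‖ = s * u := by rw [hu]; field_simp
  rw [e1]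
  have e2 : (s * u) ^ 2 / (2 * s ^ 2) = u ^ 2 / 2 := by field_simp
  rw [e2]
  have h1 : u ≤ Real.exp (u ^ 2 / 2) := by
    have := Real.add_one_le_exp (u ^ 2 / 2)
    nlinarith [sq_nonneg (u - 1)]
  have h2 : Real.exp (-(u ^ 2 / 2)) * u ≤ 1 := by
    calc _ ≤ Real.exp (-(u ^ 2 / 2)) * Real.exp (u ^ 2 / 2) := by gcongr
      _ = 1 := by rw [← Real.exp_add]; simp
  calc _ = s⁻¹ * (Real.exp (-(u ^ 2 / 2)) * u) := by field_simp
    _ ≤ s⁻¹ * 1 := by gcongr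
    _ = s⁻¹ := mul_one _

variable [FiniteDimensional ℝ E]

lemma hasFDerivAt_gaussKernel (a s : ℝ) (x z : E) :
    HasFDerivAt (fun x => gaussKernel a s x z)
      (InnerProductSpace.toDual ℝ E (gaussKernelGrad a s x z)) x := by
  have h1 : HasFDerivAt (fun x : E => x - a • z) (ContinuousLinearMap.id ℝ E) x :=
    (hasFDerivAt_id x).sub_const _
  have h2 := (((h1.norm_sq).mul_const ((2 * s ^ 2)⁻¹)).neg).exp
  refine HasFDerivAt.congr_fderiv (f := fun x => gaussKernel a s x z) h2 ?_
  ext w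
  simp only [gaussKernelGrad, gaussKernel, InnerProductSpace.toDual_apply_apply, inner_smul_left,
    _root_.smul_apply, _root_.neg_apply, Pi.neg_apply, ContinuousLinearMap.comp_apply,
    ContinuousLinearMap.id_apply, innerSL_apply_apply, smul_eq_mul, mul_inv, div_eq_mul_inv,
    conj_trivial, nsmul_eq_mul]
  push_cast
  ring

variable [MeasurableSpace E] [BorelSpace E] {ρ : Measure E} {g : E → ℝ}

lemma integrable_mul_gaussKernel (a s : ℝ) (hg : Integrable g ρ) (x : E) :
    Integrable (fun z => g z * gaussKernel a s x z) ρ := by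
  refine hg.mul_bdd (c := 1) ?_ (ae_of_all _ fun z => ?_)
  · exact ((continuous_gaussKernel a s).comp
      (by fun_prop : Continuous fun z : E => (x, z))).aestronglyMeasurable
  · rw [Real.norm_of_nonneg (gaussKernel_pos _ _ _ _).le]; exact gaussKernel_le_one _ _ _ _

lemma norm_smul_gaussKernelGrad_le (a : ℝ) {s : ℝ} (hs : 0 < s) (x z : E) :
    ‖g z • gaussKernelGrad a s x z‖ ≤ ‖g z‖ * s⁻¹ := by
  rw [norm_smul]
  gcongr
  exact norm_gaussKernelGrad_le a hs x z

lemma aestronglyMeasurable_smul_gaussKernelGrad (a s : ℝ) (hg : Integrable g ρ) (x : E) :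
    AEStronglyMeasurable (fun z => g z • gaussKernelGrad a s x z) ρ :=
  hg.aestronglyMeasurable.smul ((continuous_gaussKernelGrad a s).comp
    (by fun_prop : Continuous fun z : E => (x, z))).aestronglyMeasurable

lemma integrable_smul_gaussKernelGrad (a : ℝ) {s : ℝ} (hs : 0 < s) (hg : Integrable g ρ) (x : E) :
    Integrable (fun z => g z • gaussKernelGrad a s x z) ρ :=
  (hg.norm.mul_const s⁻¹).mono' (aestronglyMeasurable_smul_gaussKernelGrad a s hg x)
    (ae_of_all _ fun z => norm_smul_gaussKernelGrad_le a hs x z)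

lemma hasGradientAt_mixture (a : ℝ) {s : ℝ} (hs : 0 < s) (hg : Integrable g ρ) (x : E) :
    HasGradientAt (fun x => ∫ z, g z * gaussKernel a s x z ∂ρ)
      (∫ z, g z • gaussKernelGrad a s x z ∂ρ) x := by
  have hF' : ∀ x z, HasFDerivAt (fun x => g z * gaussKernel a s x z)
      (InnerProductSpace.toDual ℝ E (g z • gaussKernelGrad a s x z)) x := fun x z => by
    refine ((hasFDerivAt_gaussKernel a s x z).const_mul (g z)).congr_fderiv ?_
    rw [map_smulₛₗ]; simp
  have hm : AEStronglyMeasurable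
      (fun z => InnerProductSpace.toDual ℝ E (g z • gaussKernelGrad a s x z)) ρ :=
    (InnerProductSpace.toDual ℝ E).continuous.comp_aestronglyMeasurable
      (aestronglyMeasurable_smul_gaussKernelGrad a s hg x)
  have hi : Integrable (fun z => InnerProductSpace.toDual ℝ E (g z • gaussKernelGrad a s x z)) ρ :=
    (hg.norm.mul_const s⁻¹).mono' hm (ae_of_all _ fun z => by
      rw [LinearIsometryEquiv.norm_map]; exact norm_smul_gaussKernelGrad_le a hs x z)
  have h := hasFDerivAt_integral_of_dominated_of_fderiv_le (μ := ρ) (𝕜 := ℝ)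
    (F := fun x z => g z * gaussKernel a s x z)
    (F' := fun x z => InnerProductSpace.toDual ℝ E (g z • gaussKernelGrad a s x z))
    (x₀ := x) (s := Set.univ) (bound := fun z => ‖g z‖ * s⁻¹) univ_mem
    (Eventually.of_forall fun x => (integrable_mul_gaussKernel a s hg x).aestronglyMeasurable)
    (integrable_mul_gaussKernel a s hg x) hm
    (ae_of_all _ fun z x _ => by
      rw [LinearIsometryEquiv.norm_map]; exact norm_smul_gaussKernelGrad_le a hs x z)
    (hg.norm.mul_const _) (ae_of_all _ fun z x _ => hF' x z)
  rw [hasGradientAt_iff_hasFDerivAt]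
  refine h.congr_fderiv ?_
  ext w
  rw [ContinuousLinearMap.integral_apply hi, InnerProductSpace.toDual_apply_apply, real_inner_comm,
    ← integral_inner (integrable_smul_gaussKernelGrad a hs hg x)]
  congr 1 with z
  rw [InnerProductSpace.toDual_apply_apply, real_inner_comm]

lemma continuous_integral_smul_gaussKernelGrad (a : ℝ) {s : ℝ} (hs : 0 < s) (hg : Integrable g ρ) :
    Continuous fun x => ∫ z, g z • gaussKernelGrad a s x z ∂ρ := by
  have h : ∀ z, Continuous fun x => g z • gaussKernelGrad a s x z := fun z =>
    ((continuous_gaussKernelGrad a s).comp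
      (by fun_prop : Continuous fun x : E => (x, z))).const_smul (g z)
  have hb : Integrable (fun z => ‖g z‖ * s⁻¹) ρ := hg.norm.mul_const s⁻¹
  refine continuous_of_dominated (fun x => ?_) (fun x => ?_) hb (ae_of_all _ h)
  · exact aestronglyMeasurable_smul_gaussKernelGrad a s hg x
  · exact ae_of_all _ fun z => norm_smul_gaussKernelGrad_le a hs x z

lemma integral_mul_gaussKernel_pos [NeZero ρ] (a s : ℝ) (hg : Integrable g ρ) (hpos : ∀ z, 0 < g z)
    (x : E) : 0 < ∫ z, g z * gaussKernel a s x z ∂ρ := by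
  rw [integral_pos_iff_support_of_nonneg
    (fun z => (mul_pos (hpos z) (gaussKernel_pos _ _ _ _)).le) (integrable_mul_gaussKernel a s hg x)]
  have : Function.support (fun z => g z * gaussKernel a s x z) = Set.univ := by
    ext z; simp [(hpos z).ne', (gaussKernel_pos a s x z).ne']
  rw [this]
  exact NeZero.pos _

/-- The gradient of a differentiable function integrates to zero if the function and its gradient
are integrable. -/
lemma integral_gradient_eq_zero {f : E → ℝ} {f' : E → E} (hf : ∀ x, HasGradientAt f (f' x) x)
    (hi : Integrable f) (hi' : Integrable f') : ∫ x, f' x = 0 := by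
  refine ext_inner_left ℝ fun v => ?_
  rw [← integral_inner hi', inner_zero_right]
  have h := integral_bilinear_hasFDerivAt_right_eq_neg_left_of_integrable (μ := (volume : Measure E))
    (f := fun _ => (1 : ℝ)) (f' := fun _ => 0) (g := f)
    (g' := fun x => InnerProductSpace.toDual ℝ E (f' x)) (v := v)
    (B := ContinuousLinearMap.mul ℝ ℝ) (by simp) ?_ (by simpa using hi)
    (fun x _ => hasFDerivAt_const _ _) (fun x _ => (hf x).hasFDerivAt)
  · simpa [real_inner_comm] using h
  · simpa [real_inner_comm] using hi'.const_inner v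

end Mixture

/-! ### The score and the gradient of the value function -/

section

variable {d : ℕ} {α σ : ℝ → ℝ} (pdata : Measure (EuclideanSpace ℝ (Fin d))) [IsProbabilityMeasure pdata]

lemma weight_eq_gaussKernel {s : ℝ} (hs : 0 < s) (a : ℝ) (x z : EuclideanSpace ℝ (Fin d)) :
    weight (a / s) (s⁻¹ • x) z = gaussKernel a s x z := by
  have e : s⁻¹ • x - (a / s) • z = s⁻¹ • (x - a • z) := by
    rw [smul_sub, smul_smul, div_eq_inv_mul]
  rw [weight, gaussKernel, e, norm_smul, Real.norm_of_nonneg (inv_pos.2 hs).le]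
  congr 2
  field_simp

lemma margDensity_eq_mul_integral (t : ℝ) (x : EuclideanSpace ℝ (Fin d)) :
    margDensity α σ pdata t x = (Real.sqrt (2 * Real.pi * σ t ^ 2) ^ d)⁻¹ *
      ∫ z, 1 * gaussKernel (α t) (σ t) x z ∂pdata := by
  rw [margDensity, ← integral_const_mul]
  simp only [one_mul]
  rfl

lemma hasGradientAt_const_mul {f : EuclideanSpace ℝ (Fin d) → ℝ} {f' x : EuclideanSpace ℝ (Fin d)}
    (c : ℝ) (hf : HasGradientAt f f' x) : HasGradientAt (fun y => c * f y) (c • f') x := by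
  rw [hasGradientAt_iff_hasFDerivAt] at hf ⊢
  refine (hf.const_mul c).congr_fderiv ?_
  rw [map_smulₛₗ]; simp

lemma hasGradientAt_log {f : EuclideanSpace ℝ (Fin d) → ℝ} {f' x : EuclideanSpace ℝ (Fin d)}
    (hf : HasGradientAt f f' x) (hx : f x ≠ 0) :
    HasGradientAt (fun y => Real.log (f y)) ((f x)⁻¹ • f') x := by
  rw [hasGradientAt_iff_hasFDerivAt] at hf ⊢
  refine (hf.log hx).congr_fderiv ?_
  rw [map_smulₛₗ]; simp

lemma hasGradientAt_log_margDensity {t : ℝ} (hσ : 0 < σ t) (x : EuclideanSpace ℝ (Fin d)) :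
    HasGradientAt (fun y => Real.log (margDensity α σ pdata t y))
      ((∫ z, 1 * gaussKernel (α t) (σ t) x z ∂pdata)⁻¹ •
        ∫ z, (1 : ℝ) • gaussKernelGrad (α t) (σ t) x z ∂pdata) x := by
  have hp := integral_mul_gaussKernel_pos (ρ := pdata) (α t) (σ t) (integrable_const (1 : ℝ))
    (fun _ => one_pos) x
  have hc := sqrt_pow_inv_pos (d := d) hσ
  have h := hasGradientAt_log (hasGradientAt_const_mul (Real.sqrt (2 * Real.pi * σ t ^ 2) ^ d)⁻¹
    (hasGradientAt_mixture (ρ := pdata) (α t) hσ (integrable_const (1 : ℝ)) x)) (mul_pos hc hp).ne'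
  simp_rw [margDensity_eq_mul_integral]
  convert h using 1
  rw [smul_smul]
  congr 1
  field_simp

lemma score_eq {t : ℝ} (hσ : 0 < σ t) (x : EuclideanSpace ℝ (Fin d)) :
    score α σ pdata t x = (∫ z, 1 * gaussKernel (α t) (σ t) x z ∂pdata)⁻¹ •
        ∫ z, (1 : ℝ) • gaussKernelGrad (α t) (σ t) x z ∂pdata :=
  (hasGradientAt_log_margDensity pdata hσ x).gradient

lemma hasGradientAt_score {t : ℝ} (hσ : 0 < σ t) (x : EuclideanSpace ℝ (Fin d)) :
    HasGradientAt (fun y => Real.log (margDensity α σ pdata t y)) (score α σ pdata t x) x := by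
  rw [score_eq pdata hσ]
  exact hasGradientAt_log_margDensity pdata hσ x

lemma hasGradientAt_margDensity {t : ℝ} (hσ : 0 < σ t) (x : EuclideanSpace ℝ (Fin d)) :
    HasGradientAt (margDensity α σ pdata t) (margDensity α σ pdata t x • score α σ pdata t x) x := by
  have h := (hasGradientAt_score (α := α) pdata hσ x).hasFDerivAt.exp
  have e : (fun y => Real.exp (Real.log (margDensity α σ pdata t y))) = margDensity α σ pdata t := by
    ext y; rw [Real.exp_log (margDensity_pos pdata hσ y)]
  rw [e, Real.exp_log (margDensity_pos pdata hσ x)] at h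
  rw [hasGradientAt_iff_hasFDerivAt]
  refine h.congr_fderiv ?_
  rw [map_smulₛₗ]; simp

lemma continuous_margDensity {t : ℝ} (hσ : 0 < σ t) : Continuous (margDensity α σ pdata t) :=
  continuous_iff_continuousAt.2 fun x => (hasGradientAt_margDensity (α := α) pdata hσ x).continuousAt

lemma continuous_score {t : ℝ} (hσ : 0 < σ t) : Continuous (score α σ pdata t) := by
  have e : score α σ pdata t = fun x => (∫ z, 1 * gaussKernel (α t) (σ t) x z ∂pdata)⁻¹ •
        ∫ z, (1 : ℝ) • gaussKernelGrad (α t) (σ t) x z ∂pdata := funext fun x => score_eq pdata hσ x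
  rw [e]
  have h1 : Continuous fun x => ∫ z, 1 * gaussKernel (α t) (σ t) x z ∂pdata :=
    continuous_iff_continuousAt.2 fun x =>
      (hasGradientAt_mixture (ρ := pdata) (α t) hσ (integrable_const (1 : ℝ)) x).continuousAt
  have h2 : ∀ x, ∫ z, 1 * gaussKernel (α t) (σ t) x z ∂pdata ≠ 0 := fun x =>
    (integral_mul_gaussKernel_pos (ρ := pdata) (α t) (σ t) (integrable_const (1 : ℝ))
      (fun _ => one_pos) x).ne'
  exact (h1.inv₀ h2).smul
    (continuous_integral_smul_gaussKernelGrad (ρ := pdata) (α t) hσ (integrable_const (1 : ℝ)))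

/-- The fundamental theorem of calculus along the segment from `x` to `x_{t'}(x, ε)`. -/
lemma gammaCoeff_eq {t' : ℝ} (hσ : 0 < σ t') (t : ℝ) (x ε : EuclideanSpace ℝ (Fin d)) :
    gammaCoeff α σ pdata t' t x ε = Real.log (margDensity α σ pdata t' (renoise α σ t' t x ε)) -
      Real.log (margDensity α σ pdata t' x) := by
  rw [gammaCoeff]
  set w := renoise α σ t' t x ε - x with hw
  have hc : Continuous fun u : ℝ => score α σ pdata t' (x + u • w) :=
    (continuous_score pdata hσ).comp (by fun_prop)
  have hd : ∀ u : ℝ, HasDerivAt (fun u : ℝ => Real.log (margDensity α σ pdata t' (x + u • w)))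
      (inner ℝ w (score α σ pdata t' (x + u • w))) u := fun u => by
    have h1 : HasDerivAt (fun u : ℝ => x + u • w) w u := by
      simpa using ((hasDerivAt_id u).smul_const w).const_add x
    have h2 := (hasGradientAt_score (α := α) pdata hσ (x + u • w)).hasFDerivAt.comp_hasDerivAt u h1
    rw [InnerProductSpace.toDual_apply_apply, real_inner_comm] at h2
    exact h2
  have h3 := intervalIntegral.integral_eq_sub_of_hasDerivAt (a := 0) (b := 1) (fun u _ => hd u)
    ((continuous_const.inner hc).intervalIntegrable _ _)
  have h4 : ∫ u in (0 : ℝ)..1, inner ℝ w (score α σ pdata t' (x + u • w)) =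
      inner ℝ w (∫ u in (0 : ℝ)..1, score α σ pdata t' (x + u • w)) := by
    have := (innerSL ℝ w).intervalIntegral_comp_comm (hc.intervalIntegrable (μ := volume) 0 1)
    simpa using this
  rw [← h4, h3]
  simp [hw]

/-- The value function as the logarithm of a quotient of Gaussian mixtures, and its gradient. -/
lemma hasGradientAt_valueFn {t : ℝ} (hσ : 0 < σ t) {r : EuclideanSpace ℝ (Fin d) → ℝ}
    (hr : Integrable (fun z => Real.exp (r z)) pdata) (x : EuclideanSpace ℝ (Fin d)) :
    HasGradientAt (valueFn α σ pdata r t)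
      ((∫ z, Real.exp (r z) * gaussKernel (α t) (σ t) x z ∂pdata)⁻¹ •
        (∫ z, Real.exp (r z) • gaussKernelGrad (α t) (σ t) x z ∂pdata) - score α σ pdata t x) x := by
  have hN := fun y => integral_mul_gaussKernel_pos (α t) (σ t) hr (fun z => Real.exp_pos (r z)) y
  have hM := fun y => integral_mul_gaussKernel_pos (ρ := pdata) (α t) (σ t)
    (integrable_const (1 : ℝ)) (fun _ => one_pos) y
  have e : valueFn α σ pdata r t = fun y =>
      Real.log (∫ z, Real.exp (r z) * gaussKernel (α t) (σ t) y z ∂pdata) -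
        Real.log (∫ z, 1 * gaussKernel (α t) (σ t) y z ∂pdata) := by
    ext y
    rw [← Real.log_div (hN y).ne' (hM y).ne', valueFn, posterior_eq pdata hσ, integral_post,
      evidence, smul_eq_mul, inv_mul_eq_div]
    simp_rw [weight_eq_gaussKernel hσ, smul_eq_mul, one_mul, mul_comm]
  have h1 := hasGradientAt_log (hasGradientAt_mixture (α t) hσ hr x) (hN x).ne'
  have h2 := hasGradientAt_log (hasGradientAt_mixture (ρ := pdata) (α t) hσ
    (integrable_const (1 : ℝ)) x) (hM x).ne'
  rw [e, score_eq pdata hσ, hasGradientAt_iff_hasFDerivAt, map_sub]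
  exact h1.hasFDerivAt.sub h2.hasFDerivAt

end

/-! ### Expectations of the weights and of the weighted guidance terms -/

section

section Substitution

variable {E F : Type*} [NormedAddCommGroup E] [InnerProductSpace ℝ E] [FiniteDimensional ℝ E]
  [MeasurableSpace E] [BorelSpace E] [NormedAddCommGroup F] [NormedSpace ℝ F]

lemma integrable_comp_add_smul_iff (T : E → F) (c : E) {b : ℝ} (hb : b ≠ 0) :
    Integrable (fun e => T (c + b • e)) ↔ Integrable T := by
  rw [integrable_comp_smul_iff volume (fun y => T (c + y)) hb]
  exact ⟨fun h => by simpa using h.comp_add_left (-c), fun h => h.comp_add_left c⟩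

lemma integral_comp_add_smul (T : E → F) (c : E) (b : ℝ) :
    ∫ e, T (c + b • e) = |(b ^ Module.finrank ℝ E)⁻¹| • ∫ y, T y := by
  rw [Measure.integral_comp_smul volume (fun y => T (c + y)) b, integral_add_left_eq_self]

lemma integrable_stdGaussian_iff (G : E → F) : Integrable G (stdGaussian E) ↔
    Integrable (fun e => (gaussConst E * Real.exp (-(‖e‖ ^ 2 / 2))) • G e) := by
  have h0 : ∀ e : E, 0 ≤ gaussConst E * Real.exp (-(‖e‖ ^ 2 / 2)) := fun e =>
    mul_nonneg gaussConst_pos.le (Real.exp_pos _).le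
  rw [stdGaussian_eq_withDensity, integrable_withDensity_iff_integrable_smul' (by fun_prop)
    (ae_of_all _ fun e => by simp)]
  simp_rw [ENNReal.toReal_ofReal (h0 _)]

lemma integral_stdGaussian (G : E → F) : ∫ e, G e ∂(stdGaussian E) =
    ∫ e, (gaussConst E * Real.exp (-(‖e‖ ^ 2 / 2))) • G e := by
  have h0 : ∀ e : E, 0 ≤ gaussConst E * Real.exp (-(‖e‖ ^ 2 / 2)) := fun e =>
    mul_nonneg gaussConst_pos.le (Real.exp_pos _).le
  rw [stdGaussian_eq_withDensity, integral_withDensity_eq_integral_toReal_smul (by fun_prop)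
    (ae_of_all _ fun e => by simp)]
  simp_rw [ENNReal.toReal_ofReal (h0 _)]

end Substitution

variable {d : ℕ} {α σ : ℝ → ℝ} (pdata : Measure (EuclideanSpace ℝ (Fin d))) [IsProbabilityMeasure pdata]

section Flow

variable {F : Type*} [NormedAddCommGroup F] [NormedSpace ℝ F]
variable {X : ℝ → ℝ → EuclideanSpace ℝ (Fin d) → EuclideanSpace ℝ (Fin d)}

lemma integrable_margDensity_smul_flow (hsched : IsScheduler α σ) (hX : IsFlowMap α σ pdata X) {t : ℝ}
    (h0 : 0 ≤ t) (h1 : t < 1) (hm : Measurable (X t 1)) {h : EuclideanSpace ℝ (Fin d) → F}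
    (hh : Integrable h pdata) : Integrable fun y => margDensity α σ pdata t y • h (X t 1 y) := by
  have hσ := hsched.σ_pos h0 h1
  have hp := (continuous_margDensity (α := α) pdata hσ).measurable
  rw [← map_flow_margDensity pdata hsched hX h0 h1 hm] at hh
  have h2 := hh.comp_measurable hm
  rw [integrable_withDensity_iff_integrable_smul' hp.ennreal_ofReal (ae_of_all _ fun e => by simp)] at h2
  simpa only [ENNReal.toReal_ofReal (margDensity_pos (α := α) pdata hσ _).le, Function.comp] using h2

lemma integral_margDensity_smul_flow (hsched : IsScheduler α σ) (hX : IsFlowMap α σ pdata X) {t : ℝ}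
    (h0 : 0 ≤ t) (h1 : t < 1) (hm : Measurable (X t 1)) {h : EuclideanSpace ℝ (Fin d) → F}
    (hh : Integrable h pdata) :
    ∫ y, margDensity α σ pdata t y • h (X t 1 y) = ∫ z, h z ∂pdata := by
  have hσ := hsched.σ_pos h0 h1
  have hp := (continuous_margDensity (α := α) pdata hσ).measurable
  have hmap := map_flow_margDensity pdata hsched hX h0 h1 hm
  have h3 : AEStronglyMeasurable h ((volume.withDensity fun x =>
      ENNReal.ofReal (margDensity α σ pdata t x)).map (X t 1)) := by
    rw [hmap]; exact hh.aestronglyMeasurable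
  have h4 := integral_map hm.aemeasurable h3
  rw [hmap] at h4
  rw [h4, integral_withDensity_eq_integral_toReal_smul hp.ennreal_ofReal
    (ae_of_all _ fun e => by simp)]
  simp_rw [ENNReal.toReal_ofReal (margDensity_pos (α := α) pdata hσ _).le]

end Flow

/-- The local reward as a function of the noised point `y = x_{t'}`, for a fixed clean point `x`:
`r(X_{t',1}(y)) - ‖x - α_t X_{t',1}(y)‖² / (2 σ_t²)`. -/
def rewardAlong (α σ : ℝ → ℝ) (Y : EuclideanSpace ℝ (Fin d) → EuclideanSpace ℝ (Fin d))
    (r : EuclideanSpace ℝ (Fin d) → ℝ) (t : ℝ) (x y : EuclideanSpace ℝ (Fin d)) : ℝ :=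
  r (Y y) - ‖x - α t • Y y‖ ^ 2 / (2 * σ t ^ 2)

lemma exp_rewardAlong (Y : EuclideanSpace ℝ (Fin d) → EuclideanSpace ℝ (Fin d))
    (r : EuclideanSpace ℝ (Fin d) → ℝ) (t : ℝ) (x y : EuclideanSpace ℝ (Fin d)) :
    Real.exp (rewardAlong α σ Y r t x y) =
      Real.exp (r (Y y)) * gaussKernel (α t) (σ t) x (Y y) := by
  rw [rewardAlong, gaussKernel, ← Real.exp_add, sub_eq_add_neg]

lemma differentiable_rewardAlong {Y : EuclideanSpace ℝ (Fin d) → EuclideanSpace ℝ (Fin d)}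
    {r : EuclideanSpace ℝ (Fin d) → ℝ} (hY : Differentiable ℝ Y) (hr : Differentiable ℝ r) (t : ℝ)
    (x : EuclideanSpace ℝ (Fin d)) : Differentiable ℝ (rewardAlong α σ Y r t x) := by
  have h1 : Differentiable ℝ fun y => ‖x - α t • Y y‖ ^ 2 :=
    ((hY.const_smul (α t)).const_sub x).norm_sq ℝ
  have h2 : Differentiable ℝ fun y => ‖x - α t • Y y‖ ^ 2 / (2 * σ t ^ 2) := by
    simp_rw [div_eq_mul_inv]; exact h1.mul_const _
  exact (hr.comp hY).sub h2

/-- The local reward depends on `x` through the noised point and through the Gaussian penalty; its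
gradient is the sum of the two contributions. -/
lemma gradient_localReward {X : ℝ → ℝ → EuclideanSpace ℝ (Fin d) → EuclideanSpace ℝ (Fin d)}
    {r : EuclideanSpace ℝ (Fin d) → ℝ} (t' t : ℝ) (hY : Differentiable ℝ (X t' 1))
    (hr : Differentiable ℝ r) (x ε : EuclideanSpace ℝ (Fin d)) :
    gradient (fun y => localReward α σ X r t' t y ε) x =
      (α t' / α t) • gradient (rewardAlong α σ (X t' 1) r t x) (renoise α σ t' t x ε) -
        (σ t ^ 2)⁻¹ • (x - α t • X t' 1 (renoise α σ t' t x ε)) := by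
  set a := α t' / α t with ha
  set y₀ := renoise α σ t' t x ε with hy₀
  -- The dependence on the clean point at fixed noise splits off as an inner product that vanishes
  -- at `x`.
  have e : (fun y => localReward α σ X r t' t y ε) = fun y =>
      rewardAlong α σ (X t' 1) r t x (renoise α σ t' t y ε) +
        inner ℝ (x - y) (x + y - (2 * α t) • X t' 1 (renoise α σ t' t y ε)) * (2 * σ t ^ 2)⁻¹ := by
    ext y
    rw [localReward, rewardAlong, cleanSample]
    set z := X t' 1 (renoise α σ t' t y ε)
    have e1 : inner ℝ (x - y) (x + y - (2 * α t) • z) = ‖x - α t • z‖ ^ 2 - ‖y - α t • z‖ ^ 2 := by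
      rw [← real_inner_self_eq_norm_sq, ← real_inner_self_eq_norm_sq]
      simp only [inner_sub_left, inner_sub_right, inner_add_right, inner_smul_left, inner_smul_right,
        conj_trivial, real_inner_comm z x, real_inner_comm z y, real_inner_comm y x]
      ring
    rw [e1]; ring
  have hren : HasFDerivAt (fun y => renoise α σ t' t y ε)
      (a • ContinuousLinearMap.id ℝ (EuclideanSpace ℝ (Fin d))) x := by
    unfold renoise
    exact ((hasFDerivAt_id x).const_smul a).add_const _
  have h1 : HasFDerivAt (fun y => rewardAlong α σ (X t' 1) r t x (renoise α σ t' t y ε))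
      ((fderiv ℝ (rewardAlong α σ (X t' 1) r t x) y₀).comp
        (a • ContinuousLinearMap.id ℝ (EuclideanSpace ℝ (Fin d)))) x :=
    HasFDerivAt.comp (g := rewardAlong α σ (X t' 1) r t x) x
      ((differentiable_rewardAlong hY hr t x) y₀).hasFDerivAt hren
  have hz : HasFDerivAt (fun y => x + y - (2 * α t) • X t' 1 (renoise α σ t' t y ε))
      (ContinuousLinearMap.id ℝ (EuclideanSpace ℝ (Fin d)) - (2 * α t) • ((fderiv ℝ (X t' 1) y₀).comp
        (a • ContinuousLinearMap.id ℝ (EuclideanSpace ℝ (Fin d))))) x :=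
    ((hasFDerivAt_id x).const_add x).sub (((hY y₀).hasFDerivAt.comp x hren).const_smul (2 * α t))
  have hxy : HasFDerivAt (fun y => x - y) (-ContinuousLinearMap.id ℝ (EuclideanSpace ℝ (Fin d))) x :=
    (hasFDerivAt_id x).const_sub x
  have h2 := h1.add ((hxy.inner ℝ hz).mul_const ((2 * σ t ^ 2)⁻¹))
  refine HasGradientAt.gradient ?_
  rw [e, hasGradientAt_iff_hasFDerivAt]
  refine h2.congr_fderiv ?_
  ext w
  have hg : inner ℝ (gradient (rewardAlong α σ (X t' 1) r t x) y₀) w =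
      fderiv ℝ (rewardAlong α σ (X t' 1) r t x) y₀ w := by
    rw [gradient, InnerProductSpace.toDual_symm_apply]
  rw [InnerProductSpace.toDual_apply_apply, inner_sub_left, inner_smul_left, hg, inner_smul_left]
  simp only [_root_.add_apply, _root_.smul_apply, _root_.neg_apply, ContinuousLinearMap.comp_apply,
    ContinuousLinearMap.id_apply, ContinuousLinearMap.prod_apply, fderivInnerCLM_apply, sub_self,
    inner_zero_left, zero_add, smul_eq_mul, map_smul, conj_trivial, inner_neg_left]
  rw [← hy₀]
  have e2 : x + x - (2 * α t) • X t' 1 y₀ = (2 : ℝ) • (x - α t • X t' 1 y₀) := by module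
  rw [e2, inner_smul_right, real_inner_comm w, mul_inv]
  ring

/-- The density of the noised point `y`, tilted by the exponential of the local reward. -/
def tiltedDensity (α σ : ℝ → ℝ) (Y : EuclideanSpace ℝ (Fin d) → EuclideanSpace ℝ (Fin d))
    (r : EuclideanSpace ℝ (Fin d) → ℝ) (t' t : ℝ) (x y : EuclideanSpace ℝ (Fin d)) : ℝ :=
  margDensity α σ pdata t' y * Real.exp (rewardAlong α σ Y r t x y)

lemma hasGradientAt_tiltedDensity {Y : EuclideanSpace ℝ (Fin d) → EuclideanSpace ℝ (Fin d)}
    {r : EuclideanSpace ℝ (Fin d) → ℝ} (hY : Differentiable ℝ Y) (hr : Differentiable ℝ r)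
    {t' : ℝ} (hσ : 0 < σ t') (t : ℝ) (x y : EuclideanSpace ℝ (Fin d)) :
    HasGradientAt (tiltedDensity pdata α σ Y r t' t x)
      (tiltedDensity pdata α σ Y r t' t x y •
        (score α σ pdata t' y + gradient (rewardAlong α σ Y r t x) y)) y := by
  have h1 := (hasGradientAt_margDensity (α := α) pdata hσ y).hasFDerivAt
  have h2 := ((differentiable_rewardAlong (α := α) (σ := σ) hY hr t x) y).hasGradientAt.hasFDerivAt.exp
  have h3 := h1.mul h2
  rw [hasGradientAt_iff_hasFDerivAt]
  refine HasFDerivAt.congr_fderiv (f := tiltedDensity pdata α σ Y r t' t x) h3 ?_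
  rw [tiltedDensity, map_smulₛₗ, map_smulₛₗ, map_add]
  simp only [conj_trivial]
  module

/-- The Gaussian density times the weight `exp v` is, up to a constant, the tilted density at the
noised point: the term `‖ε‖² / 2` of `v` cancels the Gaussian and `γ` supplies the ratio of
densities. -/
lemma gaussDensity_mul_exp_logWeight
    {X : ℝ → ℝ → EuclideanSpace ℝ (Fin d) → EuclideanSpace ℝ (Fin d)}
    {r : EuclideanSpace ℝ (Fin d) → ℝ} {t' : ℝ} (hσ : 0 < σ t') (t : ℝ)
    (x ε : EuclideanSpace ℝ (Fin d)) :
    (gaussConst (EuclideanSpace ℝ (Fin d)) * Real.exp (-(‖ε‖ ^ 2 / 2))) *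
      Real.exp (logWeight α σ pdata X r t' t x ε) =
    gaussConst (EuclideanSpace ℝ (Fin d)) * (margDensity α σ pdata t' x)⁻¹ *
      tiltedDensity pdata α σ (X t' 1) r t' t x (renoise α σ t' t x ε) := by
  have h1 : localReward α σ X r t' t x ε =
      rewardAlong α σ (X t' 1) r t x (renoise α σ t' t x ε) := rfl
  rw [logWeight, gammaCoeff_eq pdata hσ, h1, tiltedDensity, Real.exp_add, Real.exp_add, Real.exp_sub,
    Real.exp_log (margDensity_pos pdata hσ _), Real.exp_log (margDensity_pos pdata hσ _)]
  have h2 : Real.exp (-(‖ε‖ ^ 2 / 2)) * Real.exp (1 / 2 * ‖ε‖ ^ 2) = 1 := by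
    rw [← Real.exp_add]; ring_nf; exact Real.exp_zero
  linear_combination (gaussConst (EuclideanSpace ℝ (Fin d)) *
    Real.exp (rewardAlong α σ (X t' 1) r t x (renoise α σ t' t x ε)) *
    (margDensity α σ pdata t' (renoise α σ t' t x ε) / margDensity α σ pdata t' x)) * h2

/-- The expectation of the weights is a multiple `κ` of the mixture `∫ exp r(z) k(x, z) pdata(dz)`,
and the expectation of the weighted guidance terms is the same multiple of the gradient of this
mixture, corrected by the score. The gradient of the tilted density, which enters through
`∇ r_local` and the score at the noised point, integrates to zero. -/
theorem exists_integral_logWeight (hsched : IsScheduler α σ)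
    {X : ℝ → ℝ → EuclideanSpace ℝ (Fin d) → EuclideanSpace ℝ (Fin d)}
    (hX : IsFlowMap α σ pdata X) {r : EuclideanSpace ℝ (Fin d) → ℝ} (hr : Differentiable ℝ r)
    (hr_int : Integrable (fun z => Real.exp (r z)) pdata) {t' t : ℝ} (ht' : 0 ≤ t') (htt' : t' < t)
    (ht : t < 1) (hX_diff : Differentiable ℝ (X t' 1)) (x : EuclideanSpace ℝ (Fin d))
    (h_int : Integrable
      (fun ε : EuclideanSpace ℝ (Fin d) => Real.exp (logWeight α σ pdata X r t' t x ε) •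
        guidanceTerm α σ pdata X r t' t x ε) (stdGaussian (EuclideanSpace ℝ (Fin d)))) :
    ∃ κ : ℝ, 0 < κ ∧
      Integrable (fun ε => Real.exp (logWeight α σ pdata X r t' t x ε))
        (stdGaussian (EuclideanSpace ℝ (Fin d))) ∧
      ∫ ε, Real.exp (logWeight α σ pdata X r t' t x ε) ∂(stdGaussian (EuclideanSpace ℝ (Fin d))) =
        κ * ∫ z, Real.exp (r z) * gaussKernel (α t) (σ t) x z ∂pdata ∧
      ∫ ε, Real.exp (logWeight α σ pdata X r t' t x ε) • guidanceTerm α σ pdata X r t' t x ε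
        ∂(stdGaussian (EuclideanSpace ℝ (Fin d))) =
        κ • ((∫ z, Real.exp (r z) • gaussKernelGrad (α t) (σ t) x z ∂pdata) -
          (∫ z, Real.exp (r z) * gaussKernel (α t) (σ t) x z ∂pdata) • score α σ pdata t x) := by
  have ht0 : 0 < t := ht'.trans_lt htt'
  have ht'1 : t' < 1 := htt'.trans ht
  have hσt := hsched.σ_pos ht0.le ht
  have hσt' := hsched.σ_pos ht' ht'1
  have hm : Measurable (X t' 1) := hX_diff.continuous.measurable
  set a := α t' / α t with ha
  set b := Real.sqrt (σ t' ^ 2 - α t' ^ 2 / α t ^ 2 * σ t ^ 2) with hb_def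
  have hb : 0 < b := by
    have hαt := hsched.α_pos ht0 ht.le
    have hαt' := hsched.α_nonneg ht' ht'1.le
    have h1 : α t' < α t := hsched.α_strictMonoOn ⟨ht', ht'1.le⟩ ⟨ht0.le, ht.le⟩ htt'
    have h2 : σ t < σ t' := hsched.σ_strictAntiOn ⟨ht', ht'1.le⟩ ⟨ht0.le, ht.le⟩ htt'
    have h3 : α t' ^ 2 / α t ^ 2 ≤ 1 := (div_le_one (by positivity)).2 (by gcongr)
    refine Real.sqrt_pos.2 ?_
    nlinarith [mul_le_mul_of_nonneg_right h3 (sq_nonneg (σ t))]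
  have hren : ∀ ε, renoise α σ t' t x ε = a • x + b • ε := fun ε => rfl
  set f := tiltedDensity pdata α σ (X t' 1) r t' t x with hf
  set C := gaussConst (EuclideanSpace ℝ (Fin d)) * (margDensity α σ pdata t' x)⁻¹ with hC
  have hC0 : 0 < C := mul_pos gaussConst_pos (inv_pos.2 (margDensity_pos pdata hσt' x))
  have hB : 0 < |(b ^ Module.finrank ℝ (EuclideanSpace ℝ (Fin d)))⁻¹| := by positivity
  have hk := integrable_mul_gaussKernel (α t) (σ t) hr_int x
  have hkg := integrable_smul_gaussKernelGrad (α t) hσt hr_int x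
  have hfX : f = fun y => margDensity α σ pdata t' y •
      (Real.exp (r (X t' 1 y)) * gaussKernel (α t) (σ t) x (X t' 1 y)) := by
    ext y; rw [hf, tiltedDensity, exp_rewardAlong, smul_eq_mul]
  have hfi : Integrable f := by
    rw [hfX]; exact integrable_margDensity_smul_flow pdata hsched hX ht' ht'1 hm hk
  have hfI : ∫ y, f y = ∫ z, Real.exp (r z) * gaussKernel (α t) (σ t) x z ∂pdata := by
    rw [hfX]; exact integral_margDensity_smul_flow pdata hsched hX ht' ht'1 hm hk
  have hgi := integrable_margDensity_smul_flow pdata hsched hX ht' ht'1 hm hkg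
  have hgI := integral_margDensity_smul_flow pdata hsched hX ht' ht'1 hm hkg
  set g := fun y => margDensity α σ pdata t' y •
    (Real.exp (r (X t' 1 y)) • gaussKernelGrad (α t) (σ t) x (X t' 1 y)) with hg
  set f' := fun y => f y • (score α σ pdata t' y + gradient (rewardAlong α σ (X t' 1) r t x) y) with hf'
  have hff' : ∀ y, HasGradientAt f (f' y) y := fun y =>
    hasGradientAt_tiltedDensity pdata hX_diff hr hσt' t x y
  let T : EuclideanSpace ℝ (Fin d) → EuclideanSpace ℝ (Fin d) := fun y =>
    a • f' y + g y - f y • score α σ pdata t x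
  have hw := fun ε => gaussDensity_mul_exp_logWeight (α := α) (X := X) (r := r) pdata hσt' t x ε
  have hT : ∀ ε, (gaussConst (EuclideanSpace ℝ (Fin d)) * Real.exp (-(‖ε‖ ^ 2 / 2))) •
      Real.exp (logWeight α σ pdata X r t' t x ε) • guidanceTerm α σ pdata X r t' t x ε =
      C • T (a • x + b • ε) := fun ε => by
    rw [smul_smul, hw, mul_smul, ← hf, ← hC]
    congr 1
    rw [guidanceTerm, gradient_localReward t' t hX_diff hr, scoreCorrection, hren, ← ha]
    simp only [T, hf', hg]
    set y := a • x + b • ε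
    have e1 : gaussKernelGrad (α t) (σ t) x (X t' 1 y) = -(gaussKernel (α t) (σ t) x (X t' 1 y) *
      (σ t ^ 2)⁻¹) • (x - α t • X t' 1 y) := rfl
    have e2 : f y = margDensity α σ pdata t' y *
      (Real.exp (r (X t' 1 y)) * gaussKernel (α t) (σ t) x (X t' 1 y)) := by simp only [hfX, smul_eq_mul]
    rw [e1, e2]
    module
  have hTi : Integrable T := by
    rw [integrable_stdGaussian_iff] at h_int
    simp_rw [hT] at h_int
    rw [integrable_fun_smul_iff hC0.ne'] at h_int
    exact (integrable_comp_add_smul_iff T (a • x) hb.ne').1 h_int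
  have hfs : Integrable fun y => f y • score α σ pdata t x := hfi.smul_const _
  -- For `t' = 0` the coefficient `a` vanishes; otherwise the integrability of the weighted terms
  -- yields that of the gradient of the tilted density.
  have haf : Integrable (fun y => a • f' y) := by
    refine ((hTi.add hfs).sub hgi).congr (ae_of_all _ fun y => ?_)
    simp only [T, Pi.add_apply, Pi.sub_apply]
    abel
  have haI : ∫ y, a • f' y = 0 := by
    rcases eq_or_ne a 0 with h0 | h0
    · simp [h0]
    · rw [integral_smul, integral_gradient_eq_zero hff' hfi ((integrable_fun_smul_iff h0 _).1 haf),
        smul_zero]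
  have hTI : ∫ y, T y = (∫ z, Real.exp (r z) • gaussKernelGrad (α t) (σ t) x z ∂pdata) -
      (∫ z, Real.exp (r z) * gaussKernel (α t) (σ t) x z ∂pdata) • score α σ pdata t x := by
    have h1 : ∫ y, T y = (∫ y, a • f' y) + (∫ y, g y) - ∫ y, f y • score α σ pdata t x := by
      have hag : Integrable (fun y => a • f' y + g y) := haf.add hgi
      rw [← integral_add haf hgi, ← integral_sub hag hfs]
    rw [h1, haI, zero_add, integral_smul_const, hfI, hgI]
  refine ⟨C * |(b ^ Module.finrank ℝ (EuclideanSpace ℝ (Fin d)))⁻¹|, mul_pos hC0 hB, ?_, ?_, ?_⟩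
  · rw [integrable_stdGaussian_iff]
    simp_rw [smul_eq_mul, hw, hren]
    exact ((integrable_comp_add_smul_iff f (a • x) hb.ne').2 hfi).const_mul C
  · rw [integral_stdGaussian]
    simp_rw [smul_eq_mul, hw, hren]
    rw [integral_const_mul, integral_comp_add_smul f, hfI, smul_eq_mul, hC]
    ring
  · rw [integral_stdGaussian]
    simp_rw [hT]
    rw [integral_smul, integral_comp_add_smul T, hTI, smul_smul]

end

/-! ### Self-normalised importance sampling -/

section

variable {S Ω F : Type*} [MeasurableSpace S] [MeasurableSpace Ω] {ν : Measure S} {P : Measure Ω}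
  [IsProbabilityMeasure P] [NormedAddCommGroup F] [NormedSpace ℝ F] [CompleteSpace F]
  [SecondCountableTopology F] [MeasurableSpace F] [BorelSpace F]

lemma aestronglyMeasurable_comp_hasLaw {G : Type*} [TopologicalSpace G] {Z : Ω → S}
    (hZ : HasLaw Z ν P) {h : S → G} (hh : AEStronglyMeasurable h ν) :
    AEStronglyMeasurable (fun ω => h (Z ω)) P := by
  rw [← hZ.map_eq] at hh
  exact hh.comp_aemeasurable hZ.aemeasurable

/-- The strong law of large numbers for an integrable function of independent samples from `ν`. -/
lemma tendsto_average_of_iIndepFun {Z : ℕ → Ω → S} (hZ : ∀ i, HasLaw (Z i) ν P)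
    (hind : iIndepFun Z P) {h : S → F} (hh : Integrable h ν) :
    ∀ᵐ ω ∂P, Tendsto (fun N : ℕ => (N : ℝ)⁻¹ • ∑ i : Fin N, h (Z i ω)) atTop (𝓝 (∫ s, h s ∂ν)) := by
  have hm : ∀ i, AEMeasurable h (P.map (Z i)) := fun i => by
    rw [(hZ i).map_eq]; exact hh.aemeasurable
  have hi : Integrable (h ∘ Z 0) P := by
    have h0 := hh
    rw [← (hZ 0).map_eq] at h0
    exact h0.comp_aemeasurable (hZ 0).aemeasurable
  have key := strong_law_ae (fun i => h ∘ Z i) hi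
    (fun i j hij => (hind.indepFun hij).comp₀ (hZ i).aemeasurable (hZ j).aemeasurable (hm i) (hm j))
    (fun i => IdentDistrib.comp_of_aemeasurable ⟨(hZ i).aemeasurable, (hZ 0).aemeasurable,
      (hZ i).map_eq.trans (hZ 0).map_eq.symm⟩ (hm i))
  have hI : ∫ ω, (h ∘ Z 0) ω ∂P = ∫ s, h s ∂ν := by
    rw [← (hZ 0).map_eq, integral_map (hZ 0).aemeasurable (hm 0).aestronglyMeasurable]
    rfl
  rw [hI] at key
  filter_upwards [key] with ω hω
  simpa only [Finset.sum_range, Function.comp] using hω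

lemma softmax_sum_smul {N : ℕ} (v : Fin N → ℝ) (g : Fin N → F) :
    ∑ i, softmax v i • g i = (∑ j, Real.exp (v j))⁻¹ • ∑ i, Real.exp (v i) • g i := by
  rw [Finset.smul_sum]
  refine Finset.sum_congr rfl fun i _ => ?_
  rw [softmax, div_eq_inv_mul, mul_smul]

/-- Softmax-weighted averages of `g` over independent samples from `ν` converge in probability to
the mean of `g` under the probability measure proportional to `exp v • ν`: numerator and
normalisation are averages to which the strong law applies. -/
lemma tendstoInMeasure_softmax_sum {Z : ℕ → Ω → S} (hZ : ∀ i, HasLaw (Z i) ν P)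
    (hind : iIndepFun Z P) {v : S → ℝ} {g : S → F} (hv : Integrable (fun s => Real.exp (v s)) ν)
    (hvg : Integrable (fun s => Real.exp (v s) • g s) ν) (h0 : ∫ s, Real.exp (v s) ∂ν ≠ 0) :
    TendstoInMeasure P
      (fun (N : ℕ) (ω : Ω) => ∑ i : Fin N, softmax (fun j : Fin N => v (Z j ω)) i • g (Z i ω)) atTop
      (fun _ => (∫ s, Real.exp (v s) ∂ν)⁻¹ • ∫ s, Real.exp (v s) • g s ∂ν) := by
  simp_rw [softmax_sum_smul]
  refine tendstoInMeasure_of_tendsto_ae (fun N => ?_) ?_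
  · have hw : ∀ i, AEMeasurable (fun ω => Real.exp (v (Z i ω))) P := fun i =>
      (aestronglyMeasurable_comp_hasLaw (hZ i) hv.aestronglyMeasurable).aemeasurable
    have h1 : AEMeasurable (fun ω => ∑ j : Fin N, Real.exp (v (Z j ω))) P :=
      Finset.aemeasurable_fun_sum _ fun j _ => hw j
    exact h1.inv.aestronglyMeasurable.smul
      (Finset.aestronglyMeasurable_fun_sum _ fun i _ =>
        aestronglyMeasurable_comp_hasLaw (hZ i) hvg.aestronglyMeasurable)
  · filter_upwards [tendsto_average_of_iIndepFun hZ hind hv,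
      tendsto_average_of_iIndepFun hZ hind hvg] with ω h1 h2
    refine ((h1.inv₀ h0).smul h2).congr' ?_
    filter_upwards [eventually_gt_atTop 0] with N hN
    have hN' : (N : ℝ) ≠ 0 := by positivity
    rw [smul_eq_mul, mul_inv, inv_inv, smul_smul]
    congr 1
    field_simp

end

end DiamondMap

end

theorem mainTheorem2 {d : ℕ} (α σ : ℝ → ℝ) (hsched : DiamondMap.IsScheduler α σ)
    (pdata : Measure (EuclideanSpace ℝ (Fin d))) [IsProbabilityMeasure pdata]
    (X : ℝ → ℝ → EuclideanSpace ℝ (Fin d) → EuclideanSpace ℝ (Fin d))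
    (hX : DiamondMap.IsFlowMap α σ pdata X)
    (r : EuclideanSpace ℝ (Fin d) → ℝ) (hr : Differentiable ℝ r)
    (hr_int : Integrable (fun z => Real.exp (r z)) pdata)
    (t' t : ℝ) (ht' : 0 ≤ t') (htt' : t' < t) (ht : t < 1)
    (hX_diff : Differentiable ℝ (X t' 1))
    (x : EuclideanSpace ℝ (Fin d))
    (h_int : Integrable
      (fun ε : EuclideanSpace ℝ (Fin d) =>
        Real.exp (DiamondMap.logWeight α σ pdata X r t' t x ε) •
          DiamondMap.guidanceTerm α σ pdata X r t' t x ε)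
      (stdGaussian (EuclideanSpace ℝ (Fin d))))
    {Ω : Type*} [MeasurableSpace Ω] (P : Measure Ω) [IsProbabilityMeasure P]
    (ε : ℕ → Ω → EuclideanSpace ℝ (Fin d))
    (hε_law : ∀ i, HasLaw (ε i) (stdGaussian (EuclideanSpace ℝ (Fin d))) P)
    (hε_indep : iIndepFun ε P) :
    DifferentiableAt ℝ (DiamondMap.valueFn α σ pdata r t) x ∧
      TendstoInMeasure P
        (fun (N : ℕ) (ω : Ω) =>
          DiamondMap.guidanceEstimator α σ pdata X r t' t x (fun i : Fin N => ε i ω))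
        atTop
        (fun _ => gradient (DiamondMap.valueFn α σ pdata r t) x) := by
  have hV := DiamondMap.hasGradientAt_valueFn (α := α) pdata (hsched.σ_pos (ht'.trans htt'.le) ht)
    hr_int x
  obtain ⟨κ, hκ, hv, hvI, hvgI⟩ := DiamondMap.exists_integral_logWeight pdata hsched hX hr hr_int
    ht' htt' ht hX_diff x h_int
  have hN := DiamondMap.integral_mul_gaussKernel_pos (α t) (σ t) hr_int
    (fun z => Real.exp_pos (r z)) x
  refine ⟨hV.differentiableAt, ?_⟩
  have hG : gradient (DiamondMap.valueFn α σ pdata r t) x =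
      (∫ e, Real.exp (DiamondMap.logWeight α σ pdata X r t' t x e)
        ∂(stdGaussian (EuclideanSpace ℝ (Fin d))))⁻¹ •
      ∫ e, Real.exp (DiamondMap.logWeight α σ pdata X r t' t x e) •
        DiamondMap.guidanceTerm α σ pdata X r t' t x e
        ∂(stdGaussian (EuclideanSpace ℝ (Fin d))) := by
    rw [hV.gradient, hvI, hvgI]
    match_scalars <;> field_simp
  rw [hG]
  exact DiamondMap.tendstoInMeasure_softmax_sum hε_law hε_indep hv h_int
    (by rw [hvI]; exact (mul_pos hκ hN).ne')
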